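/- Let $q$ be a prime power, let $V$ be a finite-dimensional vector space over $\mathbb F_q$ equipped with a symplectic (alternating bilinear), quadratic, or hermitian form, and let $\mathbb P$ be the associated polar space, whose points and lines are the totally isotropic (for a quadratic form: totally singular) subspaces of $V$ of dimension $1$ and $2$. Assume that $\mathbb P$ is nondegenerate, i.e. no point is collinear to all points, and that $\mathbb P$ has rank $d \ge 3$, i.e. $d$ is the largest vector space dimension of a totally isotropic (totally singular) subspace. Let $\Gamma_0$ be the collinearity graph of $\mathbb P$: its vertices are the points, and two distinct points are adjacent when they lie on a common line of $\mathbb P$. Then $\Gamma_0$ is strongly regular, and there are at least $(q^{d-2})!$ pairwise non-isomorphic strongly regular graphs having the same parameters $(v,k,\lambda,\mu)$ as $\Gamma_0$. Here a finite graph with $v$ vertices is strongly regular with parameters $(v,k,\lambda,\mu)$ if it is neither complete nor edgeless, every vertex has degree $k$, any two adjacent vertices have exactly $\lambda$ common neighbours, and any two distinct nonadjacent vertices have exactly $\mu$ common neighbours. -/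

import Mathlib

open scoped Nat

/-- A form of one of the three classical types on a vector space `V` over a field `K`:
an alternating bilinear (symplectic) form, a quadratic form, or a hermitian form with respect to
an involutory field automorphism `σ ≠ 1`. -/
inductive PolarForm (K V : Type*) [Field K] [AddCommGroup V] [Module K V] where
  | symplectic (B : V →ₗ[K] V →ₗ[K] K) (alt : B.IsAlt)
  | quadratic (Q : QuadraticForm K V)
  | hermitian (σ : K ≃+* K) (ne_refl : σ ≠ RingEquiv.refl K) (invol : ∀ a, σ (σ a) = a)
      (B : V →ₛₗ[(σ : K →+* K)] V →ₗ[K] K) (symm : ∀ x y, σ (B x y) = B y x)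

namespace PolarForm

variable {K V : Type*} [Field K] [AddCommGroup V] [Module K V]

/-- Totally isotropic subspaces (symplectic and hermitian forms), respectively totally singular
subspaces (quadratic forms). -/
def IsTotallySingular : PolarForm K V → Submodule K V → Prop
  | symplectic B _, W => ∀ x ∈ W, ∀ y ∈ W, B x y = 0
  | quadratic Q, W => ∀ x ∈ W, Q x = 0
  | hermitian _ _ _ B _, W => ∀ x ∈ W, ∀ y ∈ W, B x y = 0

/-- The points of the polar space: totally isotropic (singular) subspaces of dimension 1. -/
def Point (F : PolarForm K V) : Type _ :=
  {x : Submodule K V // Module.finrank K x = 1 ∧ F.IsTotallySingular x}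

/-- The lines of the polar space: totally isotropic (singular) subspaces of dimension 2. -/
def IsLine (F : PolarForm K V) (L : Submodule K V) : Prop :=
  Module.finrank K L = 2 ∧ F.IsTotallySingular L

/-- The collinearity graph: distinct points are adjacent when some line of the polar space
contains both. -/
def collinearityGraph (F : PolarForm K V) : SimpleGraph F.Point where
  Adj x y := x ≠ y ∧ ∃ L : Submodule K V, F.IsLine L ∧ x.1 ≤ L ∧ y.1 ≤ L
  symm := ⟨fun _ _ ⟨hne, L, hL, hx, hy⟩ => ⟨hne.symm, L, hL, hy, hx⟩⟩
  loopless := ⟨fun _ h => h.1 rfl⟩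

/-- The polar space is nondegenerate: no point is collinear to all (other) points. -/
def IsNondegenerate (F : PolarForm K V) : Prop :=
  ∀ x : F.Point, ∃ y : F.Point, x ≠ y ∧ ¬ F.collinearityGraph.Adj x y

/-- The polar space has rank `d`: this is the largest vector space dimension of its
singular subspaces. -/
def HasRank (F : PolarForm K V) (d : ℕ) : Prop :=
  IsGreatest {n : ℕ | ∃ W : Submodule K V, F.IsTotallySingular W ∧ Module.finrank K W = n} d

instance finite_point [Finite K] [FiniteDimensional K V] (F : PolarForm K V) :
    Finite F.Point := by
  have : Finite V := Module.finite_of_finite K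
  have : Finite (Submodule K V) :=
    Finite.of_injective (fun W : Submodule K V => (W : Set V)) SetLike.coe_injective
  exact Subtype.finite

end PolarForm

open Classical in
/-- A finite graph is strongly regular with parameters `(v, k, l, m)`: it is neither complete nor
edgeless, has `v` vertices, is regular of degree `k`, and any two adjacent (distinct nonadjacent)
vertices have exactly `l` (exactly `m`) common neighbours. -/
def IsStronglyRegular {P : Type*} [Finite P] (G : SimpleGraph P) (v k l m : ℕ) : Prop :=
  letI : Fintype P := Fintype.ofFinite P
  G ≠ ⊤ ∧ G ≠ ⊥ ∧ G.IsSRGWith v k l m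

/-!
The graphs are obtained by modifying the collinearity graph along a generator `M`, a totally
singular subspace of dimension `d`. A point `x` outside `M` is collinear to the points of the
hyperplane `x^⊥ ∩ M` of `M`, and for a permutation `τ` of the hyperplanes of `M` the twisted graph
joins `x` to the points of `τ (x^⊥ ∩ M)` instead, all other adjacencies being kept.

*Strong regularity.* That the collinearity graph is strongly regular follows from counting singular
vectors (`PolarForm.exists_hasSRGCounts`): for nonorthogonal singular `v` and `v'`, adding multiples
of `v` shows that `v^⊥` contains `|K|` times as many singular vectors as `v^⊥ ∩ v'^⊥`, so that `v`
and `v'` are orthogonal to equally many; the same holds inside `u^⊥`, and any two points are joined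
by a path of noncollinear points. Points and hyperplanes of `M` form a symmetric design. Since the
original graph is strongly regular, inverting the incidence relation of this design shows that each
hyperplane is cut out by the same number of points `x`, and that the number of points `y` collinear
to `x` that cut out a given hyperplane `H ≠ x^⊥ ∩ M` does not depend on `H`. So the parameters survive
the permutation (`SwitchSystem.hasSRGCounts_twist`).

*Isomorphisms.* The lines of the polar space are recovered from its collinearity graph by a double
perp. Suppose that `τ⁻¹` maps no pencil of all hyperplanes through a point onto such a pencil
(`PolarForm.Scatters`). Then in the twisted graph the double perp of an edge leaving `M` has only
two vertices, and `M` is recognized as the only clique of its size all of whose edges are on lines of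
`|K| + 1` vertices (`PolarForm.IsGenerator.eq_of_clique`). An isomorphism between two such graphs
therefore fixes `M`. It induces a collineation `α` on `M`, and, as lines outside `M` are still
recognized, another collineation `β` on the hyperplanes cut out by the vertices outside `M`; the two
permutations satisfy `ρ β = α τ` (`PolarForm.IsGenerator.exists_collineations_of_iso`).

*Counting.* Hence each isomorphism class comes from at most `c²` of these permutations, where `c` is
the order of the group of collineations. A collineation is determined by the images of `d` base
points and of the points on the lines joining one of them to the others, which bounds `c`
(`Projectivization.card_collineations_le`). At least half of all permutations qualify, and the
resulting number of classes is at least `(q ^ (d - 2))!` unless `q = 2` and `d = 3`. In that case two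
graphs are needed, and the collinearity graph and its twist by a transposition will do.
-/


/-! ### Redirecting a clique of a strongly regular graph along a symmetric design -/

open Classical in
/-- A clique `M` of a graph `G` carrying a symmetric design with block set `D`, such that the
neighbours in `M` of each vertex `x` outside `M` form the block `hyp x`. Here `I m H` says that the
point `m` lies on the block `H`; the values of `hyp` on `M` and of `I` off `M` play no role.
Blocks have `h` points, and two distinct blocks share `h₂` points. -/
structure SwitchSystem (P D : Type*) [Fintype P] [Fintype D] where
  G : SimpleGraph P
  M : Set P
  hyp : P → D
  I : P → D → Prop
  h : ℕ
  h₂ : ℕ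
  clique : ∀ x ∈ M, ∀ y ∈ M, x ≠ y → G.Adj x y
  adj_iff : ∀ m ∈ M, ∀ x ∉ M, G.Adj m x ↔ I m (hyp x)
  card_blocks : ∀ m ∈ M, (Finset.univ.filter fun H => I m H).card = h
  card_points : ∀ H, (Finset.univ.filter fun m => m ∈ M ∧ I m H).card = h
  card_blocks_two : ∀ m ∈ M, ∀ m' ∈ M, m ≠ m' →
    (Finset.univ.filter fun H => I m H ∧ I m' H).card = h₂
  card_points_two : ∀ H H', H ≠ H' →
    (Finset.univ.filter fun m => m ∈ M ∧ I m H ∧ I m H').card = h₂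
  h₂_lt : h₂ < h
  h_lt : h < (Finset.univ.filter fun m => m ∈ M).card

open Classical in
/-- Strong regularity with the sets of common neighbours written as filters. -/
def HasSRGCounts {P : Type*} [Fintype P] (G : SimpleGraph P) (k l μ : ℕ) : Prop :=
  (∀ x, (Finset.univ.filter fun z => G.Adj x z).card = k) ∧
  (∀ x y, G.Adj x y → (Finset.univ.filter fun z => G.Adj x z ∧ G.Adj y z).card = l) ∧
  (∀ x y, x ≠ y → ¬ G.Adj x y → (Finset.univ.filter fun z => G.Adj x z ∧ G.Adj y z).card = μ)

lemma HasSRGCounts.isStronglyRegular {P : Type*} [Fintype P] {G : SimpleGraph P} {k l μ : ℕ}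
    (hG : HasSRGCounts G k l μ) (ht : G ≠ ⊤) (hb : G ≠ ⊥) :
    IsStronglyRegular G (Nat.card P) k l μ := by
  classical
  obtain ⟨h1, h2, h3⟩ := hG
  refine ⟨ht, hb, ?_⟩
  refine @SimpleGraph.IsSRGWith.mk _ (_) _ (_) _ _ _ _ ?_ ?_ ?_ ?_
  · rw [Nat.card_eq_fintype_card]; congr!
  · intro x
    rw [← h1 x, ← SimpleGraph.card_neighborFinset_eq_degree]
    congr 1
    ext z
    simp
  · intro x y hxy
    rw [← h2 x y hxy, Fintype.card_subtype]
    congr 1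
  · intro x y hxy hn
    rw [← h3 x y hxy hn, Fintype.card_subtype]
    congr 1

namespace SwitchSystem

variable {P D : Type*} [Fintype P] [Fintype D] (s : SwitchSystem P D)

/-- The graph obtained from `s.G` by joining each vertex `x` outside `M` to the points of the
block `τ (hyp x)` in place of those of `hyp x`. -/
def twist (τ : Equiv.Perm D) : SimpleGraph P where
  Adj x y := (x ∈ s.M ∧ y ∈ s.M ∧ x ≠ y) ∨ (x ∉ s.M ∧ y ∉ s.M ∧ s.G.Adj x y) ∨
    (x ∈ s.M ∧ y ∉ s.M ∧ s.I x (τ (s.hyp y))) ∨ (x ∉ s.M ∧ y ∈ s.M ∧ s.I y (τ (s.hyp x)))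
  symm := ⟨fun x y h => by
    rcases h with ⟨a, b, c⟩ | ⟨a, b, c⟩ | ⟨a, b, c⟩ | ⟨a, b, c⟩
    · exact Or.inl ⟨b, a, c.symm⟩
    · exact Or.inr (Or.inl ⟨b, a, c.symm⟩)
    · exact Or.inr (Or.inr (Or.inr ⟨b, a, c⟩))
    · exact Or.inr (Or.inr (Or.inl ⟨b, a, c⟩))⟩
  loopless := ⟨fun x h => by
    rcases h with ⟨a, b, c⟩ | ⟨a, b, c⟩ | ⟨a, b, c⟩ | ⟨a, b, c⟩
    · exact c rfl
    · exact s.G.loopless.irrefl x c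
    · exact b a
    · exact a b⟩

variable {s}

lemma twist_adj_in {τ : Equiv.Perm D} {x y : P} (hx : x ∈ s.M) (hy : y ∈ s.M) :
    (s.twist τ).Adj x y ↔ x ≠ y := by
  simp [twist, hx, hy]

lemma twist_adj_out {τ : Equiv.Perm D} {x y : P} (hx : x ∉ s.M) (hy : y ∉ s.M) :
    (s.twist τ).Adj x y ↔ s.G.Adj x y := by
  simp [twist, hx, hy]

lemma twist_adj_mixed {τ : Equiv.Perm D} {x y : P} (hx : x ∈ s.M) (hy : y ∉ s.M) :
    (s.twist τ).Adj x y ↔ s.I x (τ (s.hyp y)) := by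
  simp [twist, hx, hy]

lemma twist_adj_mixed' {τ : Equiv.Perm D} {x y : P} (hx : x ∉ s.M) (hy : y ∈ s.M) :
    (s.twist τ).Adj x y ↔ s.I y (τ (s.hyp x)) := by
  simp [twist, hx, hy]

variable (s)

lemma twist_one : s.twist 1 = s.G := by
  ext x y
  by_cases hx : x ∈ s.M <;> by_cases hy : y ∈ s.M
  · rw [twist_adj_in hx hy]
    exact ⟨s.clique x hx y hy, fun h => h.ne⟩
  · rw [twist_adj_mixed hx hy, s.adj_iff x hx y hy]; rfl
  · rw [twist_adj_mixed' hx hy, s.G.adj_comm, s.adj_iff y hy x hx]; rfl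
  · rw [twist_adj_out hx hy]

open Classical in
/-- Double counting in the design: the sums of `g` over the blocks through the points of `H₀`
determine `g H₀` in terms of the sum of all values of `g`. -/
lemma sum_points_sum_blocks (g : D → ℕ) (H₀ : D) :
    (∑ m ∈ Finset.univ.filter (fun m => m ∈ s.M ∧ s.I m H₀),
      ∑ H ∈ Finset.univ.filter (fun H => s.I m H), g H) + s.h₂ * g H₀ =
      s.h₂ * ∑ H, g H + s.h * g H₀ := by
  have h1 : (∑ m ∈ Finset.univ.filter (fun m => m ∈ s.M ∧ s.I m H₀),
      ∑ H ∈ Finset.univ.filter (fun H => s.I m H), g H) =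
      ∑ H, (Finset.univ.filter fun m => m ∈ s.M ∧ s.I m H₀ ∧ s.I m H).card * g H := by
    simp_rw [Finset.sum_filter (p := fun H => s.I _ H)]
    rw [Finset.sum_comm]
    refine Finset.sum_congr rfl fun H _ => ?_
    rw [← Finset.sum_filter, Finset.sum_const, smul_eq_mul, Finset.filter_filter]
    congr 3
    ext m
    simp [and_assoc]
  rw [h1, ← Finset.add_sum_erase _ _ (Finset.mem_univ H₀), ← Finset.add_sum_erase _ g
    (Finset.mem_univ H₀), mul_add]
  have h2 : ∑ H ∈ Finset.univ.erase H₀,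
      (Finset.univ.filter fun m => m ∈ s.M ∧ s.I m H₀ ∧ s.I m H).card * g H =
      s.h₂ * ∑ H ∈ Finset.univ.erase H₀, g H := by
    rw [Finset.mul_sum]
    refine Finset.sum_congr rfl fun H hH => ?_
    rw [s.card_points_two H₀ H (Finset.ne_of_mem_erase hH).symm]
  have h3 : (Finset.univ.filter fun m => m ∈ s.M ∧ s.I m H₀ ∧ s.I m H₀).card = s.h := by
    rw [← s.card_points H₀]; simp
  rw [h2, h3]; ring

open Classical in
lemma card_filter_eq_sum (p : P → Prop) (q : D → Prop) [DecidablePred q]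
    [DecidablePred fun x => p x ∧ q (s.hyp x)] [∀ H, DecidablePred fun x => p x ∧ s.hyp x = H] :
    (Finset.univ.filter fun x => p x ∧ q (s.hyp x)).card =
      ∑ H ∈ Finset.univ.filter q, (Finset.univ.filter fun x => p x ∧ s.hyp x = H).card := by
  rw [Finset.card_eq_sum_card_fiberwise (f := s.hyp) (t := Finset.univ.filter q)]
  · refine Finset.sum_congr rfl fun H hH => ?_
    rw [Finset.filter_filter]
    congr 1
    ext x
    simp only [Finset.mem_filter, Finset.mem_univ, true_and] at hH ⊢
    constructor
    · rintro ⟨⟨a, b⟩, c⟩; exact ⟨a, c⟩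
    · rintro ⟨a, c⟩; exact ⟨⟨a, c ▸ hH⟩, c⟩
  · intro x hx
    simp only [Finset.coe_filter, Finset.mem_univ, true_and, Set.mem_ofPred_eq] at hx ⊢
    exact hx.2

open Classical in
lemma card_split (p : P → Prop) [DecidablePred p] [DecidablePred fun x => x ∈ s.M ∧ p x]
    [DecidablePred fun x => x ∉ s.M ∧ p x] : (Finset.univ.filter p).card =
    (Finset.univ.filter fun x => x ∈ s.M ∧ p x).card +
    (Finset.univ.filter fun x => x ∉ s.M ∧ p x).card := by
  rw [← Finset.card_filter_add_card_filter_not (s := Finset.univ.filter p) (fun x => x ∈ s.M),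
    Finset.filter_filter, Finset.filter_filter]
  simp only [and_comm]

open Classical in
/-- Each block is attached to the same number of vertices outside `M`. -/
lemma card_hyp_eq {k l μ : ℕ} (hG : HasSRGCounts s.G k l μ) :
    ∃ c, ∀ H, (Finset.univ.filter fun x => x ∉ s.M ∧ s.hyp x = H).card = c := by
  set g : D → ℕ := fun H => (Finset.univ.filter fun x => x ∉ s.M ∧ s.hyp x = H).card with hg
  have hsum : ∀ m ∈ s.M, ∑ H ∈ Finset.univ.filter (fun H => s.I m H), g H =
      k - (Finset.univ.filter fun x => x ∈ s.M ∧ m ≠ x).card := by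
    intro m hm
    simp only [hg]
    rw [← s.card_filter_eq_sum (fun x => x ∉ s.M) (fun H => s.I m H), ← hG.1 m,
      s.card_split (fun z => s.G.Adj m z), eq_comm, Nat.sub_eq_of_eq_add]
    rw [add_comm]
    congr 1
    · congr 1; ext x; simp only [Finset.mem_filter, Finset.mem_univ, true_and]
      refine and_congr_right fun hx => (s.adj_iff m hm x hx)
    · congr 1; ext x; simp only [Finset.mem_filter, Finset.mem_univ, true_and]
      exact and_congr_right fun hx => ⟨fun h => h.ne, fun h => s.clique m hm x hx h⟩
  have herase : ∀ m ∈ s.M, (Finset.univ.filter fun x => x ∈ s.M ∧ m ≠ x).card =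
      (Finset.univ.filter fun x => x ∈ s.M).card - 1 := by
    intro m hm
    rw [← Finset.card_erase_of_mem (a := m) (by simpa using hm)]
    congr 1; ext x; simp [and_comm, eq_comm]
  have hconst : ∀ H, s.h * (k - ((Finset.univ.filter fun x => x ∈ s.M).card - 1)) + s.h₂ * g H =
      s.h₂ * ∑ H, g H + s.h * g H := by
    intro H
    rw [← s.sum_points_sum_blocks g H]
    congr 1
    rw [Finset.sum_congr rfl (g := fun _ => k - ((Finset.univ.filter fun x => x ∈ s.M).card - 1)),
      Finset.sum_const, s.card_points, smul_eq_mul]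
    intro m hm
    simp only [Finset.mem_filter, Finset.mem_univ, true_and] at hm
    rw [hsum m hm.1, herase m hm.1]
  rcases isEmpty_or_nonempty D with hD | ⟨⟨H₁⟩⟩
  · exact ⟨0, fun H => hD.elim H⟩
  refine ⟨g H₁, fun H => ?_⟩
  have e1 := hconst H
  have e2 := hconst H₁
  have := s.h₂_lt
  change g H = g H₁
  zify at *
  have : ((s.h : ℤ) - s.h₂) * (g H - g H₁) = 0 := by linear_combination e2 - e1
  rcases mul_eq_zero.mp this with h | h <;> linarith

open Classical in
/-- For a vertex `x` outside `M`, each block other than `hyp x` is attached to the same number of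
neighbours of `x` outside `M`. -/
lemma card_adj_hyp_eq {k l μ : ℕ} (hG : HasSRGCounts s.G k l μ) {x : P} (hx : x ∉ s.M) :
    ∃ a, ∀ H, H ≠ s.hyp x →
      (Finset.univ.filter fun y => (y ∉ s.M ∧ s.G.Adj x y) ∧ s.hyp y = H).card = a := by
  set g : D → ℕ := fun H =>
    (Finset.univ.filter fun y => (y ∉ s.M ∧ s.G.Adj x y) ∧ s.hyp y = H).card with hg
  have hsum0 : ∀ m ∈ s.M, (Finset.univ.filter fun z => s.G.Adj x z ∧ s.G.Adj m z).card =
      (Finset.univ.filter fun z => (z ∈ s.M ∧ s.I z (s.hyp x)) ∧ m ≠ z).card +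
      ∑ H ∈ Finset.univ.filter (fun H => s.I m H), g H := by
    intro m hm
    simp only [hg]
    rw [← s.card_filter_eq_sum (fun y => y ∉ s.M ∧ s.G.Adj x y) (fun H => s.I m H),
      s.card_split]
    congr 1
    · congr 1; ext z; simp only [Finset.mem_filter, Finset.mem_univ, true_and, and_assoc]
      refine and_congr_right fun hz => ?_
      rw [s.G.adj_comm, s.adj_iff z hz x hx]
      exact and_congr_right fun _ => ⟨fun h => h.ne, fun h => s.clique m hm z hz h⟩
    · congr 1; ext z; simp only [Finset.mem_filter, Finset.mem_univ, true_and, and_assoc]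
      refine and_congr_right fun hz => and_congr_right fun _ => s.adj_iff m hm z hz
  have hsum1 : ∀ m ∈ s.M, s.I m (s.hyp x) →
      ∑ H ∈ Finset.univ.filter (fun H => s.I m H), g H = l - (s.h - 1) := by
    intro m hm hI
    have h1 := hsum0 m hm
    rw [hG.2.1 x m (((s.adj_iff m hm x hx).2 hI).symm)] at h1
    rw [h1, ← s.card_points (s.hyp x), ← Finset.card_erase_of_mem (a := m)
      (by simpa using ⟨hm, hI⟩)]
    rw [Nat.sub_eq_of_eq_add]
    rw [add_comm]
    congr 2
    ext z; simp [and_comm, eq_comm]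
  have hsum2 : ∀ m ∈ s.M, ¬ s.I m (s.hyp x) →
      ∑ H ∈ Finset.univ.filter (fun H => s.I m H), g H = μ - s.h := by
    intro m hm hI
    have h1 := hsum0 m hm
    rw [hG.2.2 x m (fun h => hx (h ▸ hm))
      (fun h => hI ((s.adj_iff m hm x hx).1 h.symm))] at h1
    rw [h1, ← s.card_points (s.hyp x)]
    rw [Nat.sub_eq_of_eq_add]
    rw [add_comm]
    congr 2
    ext z
    simp only [Finset.mem_filter, Finset.mem_univ, true_and, and_iff_left_iff_imp]
    rintro ⟨_, h⟩ rfl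
    exact hI h
  have hconst : ∀ H, H ≠ s.hyp x → (s.h₂ * (l - (s.h - 1)) + (s.h - s.h₂) * (μ - s.h)) +
      s.h₂ * g H = s.h₂ * ∑ H, g H + s.h * g H := by
    intro H hH
    rw [← s.sum_points_sum_blocks g H]
    congr 1
    rw [← Finset.sum_filter_add_sum_filter_not _ (fun m => s.I m (s.hyp x))]
    have c1 := s.card_points_two H (s.hyp x) hH
    have c2 := s.card_points H
    rw [← Finset.card_filter_add_card_filter_not (fun m => s.I m (s.hyp x)),
      Finset.filter_filter] at c2
    simp only [and_assoc] at c2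
    rw [c1, ] at c2
    rw [Finset.sum_congr rfl (g := fun _ => l - (s.h - 1)), Finset.sum_const, smul_eq_mul,
      Finset.sum_congr rfl (g := fun _ => μ - s.h), Finset.sum_const, smul_eq_mul]
    · congr 2
      · rw [Finset.filter_filter]; simp only [and_assoc]; rw [c1]
      · omega
    · intro m hm
      simp only [Finset.mem_filter, Finset.mem_univ, true_and] at hm
      exact hsum2 m hm.1.1 hm.2
    · intro m hm
      simp only [Finset.mem_filter, Finset.mem_univ, true_and] at hm
      exact hsum1 m hm.1.1 hm.2
  by_cases hD : ∃ H₁, H₁ ≠ s.hyp x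
  · obtain ⟨H₁, hH₁⟩ := hD
    refine ⟨g H₁, fun H hH => ?_⟩
    have e1 := hconst H hH
    have e2 := hconst H₁ hH₁
    have := s.h₂_lt
    change g H = g H₁
    generalize (s.h₂ * (l - (s.h - 1)) + (s.h - s.h₂) * (μ - s.h)) = A at e1 e2
    zify at *
    have : ((s.h : ℤ) - s.h₂) * (g H - g H₁) = 0 := by linear_combination e2 - e1
    rcases mul_eq_zero.mp this with h | h <;> linarith
  · push Not at hD
    exact ⟨0, fun H hH => absurd (hD H) hH⟩

open Classical in
lemma card_perm (τ : Equiv.Perm D) (p : D → Prop) [DecidablePred p]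
    [DecidablePred fun H => p (τ H)] :
    (Finset.univ.filter fun H => p (τ H)).card = (Finset.univ.filter p).card :=
  Finset.card_bij (fun H _ => τ H) (by simp) (by simp) (fun H hH => ⟨τ.symm H, by simpa using hH⟩)

open Classical in
/-- The number of common neighbours in `s.twist τ` of a vertex in `M` and a vertex outside `M`
depends neither on `τ` nor on the vertex in `M`, beyond adjacency. -/
lemma exists_card_common_mixed {k l μ : ℕ} (hG : HasSRGCounts s.G k l μ) {x : P} (hx : x ∉ s.M) :
    ∃ A B, ∀ (τ : Equiv.Perm D), ∀ m ∈ s.M,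
      (Finset.univ.filter fun z => (s.twist τ).Adj x z ∧ (s.twist τ).Adj m z).card =
        if s.I m (τ (s.hyp x)) then A else B := by
  obtain ⟨a, ha⟩ := s.card_adj_hyp_eq hG hx
  set g : D → ℕ := fun H =>
    (Finset.univ.filter fun y => (y ∉ s.M ∧ s.G.Adj x y) ∧ s.hyp y = H).card with hg
  refine ⟨(s.h - 1) + (g (s.hyp x) + (s.h - 1) * a), s.h + s.h * a, fun τ m hm => ?_⟩
  rw [s.card_split]
  have e1 : (Finset.univ.filter fun z => z ∈ s.M ∧ (s.twist τ).Adj x z ∧ (s.twist τ).Adj m z) =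
      (Finset.univ.filter fun z => z ∈ s.M ∧ s.I z (τ (s.hyp x))).erase m := by
    ext z
    simp only [Finset.mem_filter, Finset.mem_univ, true_and, Finset.mem_erase]
    constructor
    · rintro ⟨hz, h1, h2⟩
      exact ⟨h2.ne.symm, hz, (twist_adj_mixed' hx hz).1 h1⟩
    · rintro ⟨h1, hz, h2⟩
      exact ⟨hz, (twist_adj_mixed' hx hz).2 h2, (twist_adj_in hm hz).2 h1.symm⟩
  have e2 : (Finset.univ.filter fun z => z ∉ s.M ∧ (s.twist τ).Adj x z ∧ (s.twist τ).Adj m z).card =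
      ∑ H ∈ Finset.univ.filter (fun H => s.I m (τ H)), g H := by
    simp only [hg]
    rw [← s.card_filter_eq_sum (fun y => y ∉ s.M ∧ s.G.Adj x y) (fun H => s.I m (τ H))]
    congr 1; ext z; simp only [Finset.mem_filter, Finset.mem_univ, true_and, and_assoc]
    refine and_congr_right fun hz => ?_
    rw [twist_adj_out hx hz, twist_adj_mixed hm hz]
  have e3 : (Finset.univ.filter (fun H => s.I m (τ H))).card = s.h := by
    rw [card_perm τ (fun H => s.I m H), s.card_blocks m hm]
  rw [e1, e2]
  split_ifs with hI
  · rw [Finset.card_erase_of_mem (by simpa using ⟨hm, hI⟩), s.card_points,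
      ← Finset.add_sum_erase _ _ (a := s.hyp x) (by simpa using hI)]
    congr 2
    rw [Finset.sum_congr rfl (g := fun _ => a) (fun H hH => ha H (Finset.ne_of_mem_erase hH)),
      Finset.sum_const, Finset.card_erase_of_mem (by simpa using hI), e3, smul_eq_mul]
  · rw [Finset.erase_eq_of_notMem (by simpa using fun _ => hI), s.card_points]
    congr 1
    rw [Finset.sum_congr rfl (g := fun _ => a), Finset.sum_const, e3, smul_eq_mul]
    intro H hH
    refine ha H ?_
    rintro rfl
    simp only [Finset.mem_filter, Finset.mem_univ, true_and] at hH
    exact hI hH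

open Classical in
lemma card_common_in {k l μ : ℕ} (hG : HasSRGCounts s.G k l μ) (τ : Equiv.Perm D) {m m' : P}
    (hm : m ∈ s.M) (hm' : m' ∈ s.M) (hne : m ≠ m') :
    (Finset.univ.filter fun z => (s.twist τ).Adj m z ∧ (s.twist τ).Adj m' z).card = l := by
  obtain ⟨c, hc⟩ := s.card_hyp_eq hG
  have key : ∀ ρ : Equiv.Perm D,
      (Finset.univ.filter fun z => (s.twist ρ).Adj m z ∧ (s.twist ρ).Adj m' z).card =
      (Finset.univ.filter fun z => z ∈ s.M ∧ m ≠ z ∧ m' ≠ z).card + s.h₂ * c := by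
    intro ρ
    rw [s.card_split]
    congr 1
    · congr 1; ext z; simp only [Finset.mem_filter, Finset.mem_univ, true_and]
      refine and_congr_right fun hz => ?_
      rw [twist_adj_in hm hz, twist_adj_in hm' hz]
    · have : (Finset.univ.filter fun z => z ∉ s.M ∧ (s.twist ρ).Adj m z ∧ (s.twist ρ).Adj m' z) =
        (Finset.univ.filter fun z => z ∉ s.M ∧ (s.I m (ρ (s.hyp z)) ∧ s.I m' (ρ (s.hyp z)))) := by
        ext z; simp only [Finset.mem_filter, Finset.mem_univ, true_and]
        refine and_congr_right fun hz => ?_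
        rw [twist_adj_mixed hm hz, twist_adj_mixed hm' hz]
      rw [this, s.card_filter_eq_sum (fun z => z ∉ s.M) (fun H => s.I m (ρ H) ∧ s.I m' (ρ H)),
        Finset.sum_congr rfl (fun H _ => hc H), Finset.sum_const,
        card_perm ρ (fun H => s.I m H ∧ s.I m' H), s.card_blocks_two m hm m' hm' hne, smul_eq_mul]
  rw [key τ, ← key 1, twist_one, hG.2.1 m m' (s.clique m hm m' hm' hne)]

open Classical in
lemma card_common_out (τ : Equiv.Perm D) {x y : P} (hx : x ∉ s.M) (hy : y ∉ s.M) :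
    (Finset.univ.filter fun z => (s.twist τ).Adj x z ∧ (s.twist τ).Adj y z).card =
    (Finset.univ.filter fun z => s.G.Adj x z ∧ s.G.Adj y z).card := by
  have key : ∀ ρ : Equiv.Perm D,
      (Finset.univ.filter fun z => (s.twist ρ).Adj x z ∧ (s.twist ρ).Adj y z).card =
      (if s.hyp x = s.hyp y then s.h else s.h₂) +
      (Finset.univ.filter fun z => z ∉ s.M ∧ s.G.Adj x z ∧ s.G.Adj y z).card := by
    intro ρ
    rw [s.card_split]
    congr 1
    · have : (Finset.univ.filter fun z => z ∈ s.M ∧ (s.twist ρ).Adj x z ∧ (s.twist ρ).Adj y z) =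
        (Finset.univ.filter fun z => z ∈ s.M ∧ s.I z (ρ (s.hyp x)) ∧ s.I z (ρ (s.hyp y))) := by
        ext z; simp only [Finset.mem_filter, Finset.mem_univ, true_and]
        refine and_congr_right fun hz => ?_
        rw [twist_adj_mixed' hx hz, twist_adj_mixed' hy hz]
      rw [this]
      split_ifs with h
      · rw [h]; simpa using s.card_points (ρ (s.hyp y))
      · exact s.card_points_two _ _ (fun e => h (ρ.injective e))
    · congr 1; ext z; simp only [Finset.mem_filter, Finset.mem_univ, true_and]
      refine and_congr_right fun hz => ?_
      rw [twist_adj_out hx hz, twist_adj_out hy hz]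
  rw [key τ, ← key 1, twist_one]

open Classical in
lemma card_adj (τ : Equiv.Perm D) {k l μ : ℕ} (hG : HasSRGCounts s.G k l μ) (x : P) :
    (Finset.univ.filter fun z => (s.twist τ).Adj x z).card = k := by
  by_cases hx : x ∈ s.M
  · obtain ⟨c, hc⟩ := s.card_hyp_eq hG
    have key : ∀ ρ : Equiv.Perm D, (Finset.univ.filter fun z => (s.twist ρ).Adj x z).card =
        (Finset.univ.filter fun z => z ∈ s.M ∧ x ≠ z).card + s.h * c := by
      intro ρ
      rw [s.card_split]
      congr 1
      · congr 1; ext z; simp only [Finset.mem_filter, Finset.mem_univ, true_and]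
        refine and_congr_right fun hz => twist_adj_in hx hz
      · have : (Finset.univ.filter fun z => z ∉ s.M ∧ (s.twist ρ).Adj x z) =
          (Finset.univ.filter fun z => z ∉ s.M ∧ s.I x (ρ (s.hyp z))) := by
          ext z; simp only [Finset.mem_filter, Finset.mem_univ, true_and]
          exact and_congr_right fun hz => twist_adj_mixed hx hz
        rw [this, s.card_filter_eq_sum (fun z => z ∉ s.M) (fun H => s.I x (ρ H)),
          Finset.sum_congr rfl (fun H _ => hc H), Finset.sum_const,
          card_perm ρ (fun H => s.I x H), s.card_blocks x hx, smul_eq_mul]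
    rw [key τ, ← key 1, twist_one, hG.1]
  · have := s.card_common_out τ hx hx
    simp only [and_self] at this
    rw [this, hG.1]

/-- Redirecting the edges between `M` and its complement along a permutation of the blocks
preserves the parameters of a strongly regular graph. -/
theorem hasSRGCounts_twist {k l μ : ℕ} (hG : HasSRGCounts s.G k l μ) (τ : Equiv.Perm D) :
    HasSRGCounts (s.twist τ) k l μ := by
  classical
  have hmix : ∀ x ∉ s.M, ∀ m ∈ s.M,
      (Finset.univ.filter fun z => (s.twist τ).Adj x z ∧ (s.twist τ).Adj m z).card =
        if s.I m (τ (s.hyp x)) then l else μ := by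
    intro x hx m hm
    obtain ⟨A, B, hAB⟩ := s.exists_card_common_mixed hG hx
    -- The constants `A` and `B` are read off from the original graph.
    have hA : A = l := by
      have hpos : 0 < (Finset.univ.filter fun m => m ∈ s.M ∧ s.I m (s.hyp x)).card := by
        rw [s.card_points]; exact (Nat.zero_le _).trans_lt s.h₂_lt
      obtain ⟨m₀, hm₀⟩ := Finset.card_pos.1 hpos
      simp only [Finset.mem_filter, Finset.mem_univ, true_and] at hm₀
      have := hAB 1 m₀ hm₀.1
      rw [if_pos (by exact hm₀.2), twist_one,
        hG.2.1 x m₀ ((s.adj_iff m₀ hm₀.1 x hx).2 hm₀.2).symm] at this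
      exact this.symm
    have hB : B = μ := by
      have : ∃ m₀ ∈ s.M, ¬ s.I m₀ (s.hyp x) := by
        by_contra! hall
        have := s.h_lt
        rw [← s.card_points (s.hyp x)] at this
        refine this.not_ge (Finset.card_le_card fun z hz => ?_)
        simp only [Finset.mem_filter, Finset.mem_univ, true_and] at hz ⊢
        exact ⟨hz, hall z hz⟩
      obtain ⟨m₀, hm₀, hI⟩ := this
      have := hAB 1 m₀ hm₀
      rw [if_neg (by exact hI), twist_one, hG.2.2 x m₀ (fun h => hx (h ▸ hm₀))
        (fun h => hI ((s.adj_iff m₀ hm₀ x hx).1 h.symm))] at this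
      exact this.symm
    rw [hAB τ m hm, hA, hB]
  refine ⟨s.card_adj τ hG, fun x y hxy => ?_, fun x y hne hxy => ?_⟩
  · by_cases hx : x ∈ s.M <;> by_cases hy : y ∈ s.M
    · exact s.card_common_in hG τ hx hy hxy.ne
    · simp_rw [and_comm (a := (s.twist τ).Adj x _)]
      rw [hmix y hy x hx, if_pos ((twist_adj_mixed hx hy).1 hxy)]
    · rw [hmix x hx y hy, if_pos ((twist_adj_mixed' hx hy).1 hxy)]
    · rw [s.card_common_out τ hx hy, hG.2.1 x y ((twist_adj_out hx hy).1 hxy)]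
  · by_cases hx : x ∈ s.M <;> by_cases hy : y ∈ s.M
    · exact absurd ((twist_adj_in hx hy).2 hne) hxy
    · simp_rw [and_comm (a := (s.twist τ).Adj x _)]
      rw [hmix y hy x hx, if_neg (fun h => hxy ((twist_adj_mixed hx hy).2 h))]
    · rw [hmix x hx y hy, if_neg (fun h => hxy ((twist_adj_mixed' hx hy).2 h))]
    · rw [s.card_common_out τ hx hy, hG.2.2 x y hne (fun h => hxy ((twist_adj_out hx hy).2 h))]

end SwitchSystem

/-! ### Polar spaces from vectors and orthogonality -/

/-- The data of a polar form in which the three types are treated alike: a map `f` whose vanishing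
is orthogonality, and the set `S` of singular vectors (with `0` included). Only linearity of `f` in
its second argument is recorded; together with the symmetry of orthogonality this makes the set of
vectors orthogonal to a given one a subspace, on either side. -/
structure PolarData (K V : Type*) [Field K] [AddCommGroup V] [Module K V] where
  f : V → V →ₗ[K] K
  S : V → Prop
  S_zero : S 0
  symm : ∀ x y, f x y = 0 → f y x = 0
  self : ∀ x, S x → f x x = 0
  add : ∀ x y, S x → S y → f x y = 0 → S (x + y)
  smul : ∀ (c : K) x, S x → S (c • x)

namespace PolarForm

variable {K V : Type*} [Field K] [AddCommGroup V] [Module K V]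

/-- Orthogonality and singular vectors of a polar form. For a quadratic form, orthogonality is
that of its polarization. -/
def data : PolarForm K V → PolarData K V
  | symplectic B alt =>
    { f := fun x => B x
      S := fun _ => True
      S_zero := trivial
      symm := fun x y h => by rw [← alt.neg, h, neg_zero]
      self := fun x _ => alt x
      add := fun _ _ _ _ _ => trivial
      smul := fun _ _ _ => trivial }
  | quadratic Q =>
    { f := fun x => Q.polarBilin x
      S := fun x => Q x = 0
      S_zero := Q.map_zero
      symm := fun x y h => by
        rw [QuadraticMap.polarBilin_apply_apply] at h ⊢
        rwa [QuadraticMap.polar_comm]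
      self := fun x h => by
        rw [QuadraticMap.polarBilin_apply_apply, QuadraticMap.polar_self, h, smul_zero]
      add := fun x y hx hy h => by
        rw [QuadraticMap.polarBilin_apply_apply] at h
        rw [QuadraticMap.map_add Q, hx, hy, h]; simp
      smul := fun c x h => by rw [QuadraticMap.map_smul, h, smul_zero] }
  | hermitian σ _ _ B symm =>
    { f := fun x => B x
      S := fun x => B x x = 0
      S_zero := by simp
      symm := fun x y h => by rw [← symm, h, map_zero]
      self := fun x h => h
      add := fun x y hx hy h => by
        have h' : B y x = 0 := by rw [← symm, h, map_zero]
        simp [hx, hy, h, h']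
      smul := fun c x h => by simp [h] }

lemma isTotallySingular_iff (F : PolarForm K V) (W : Submodule K V) :
    F.IsTotallySingular W ↔ (∀ x ∈ W, F.data.S x) ∧ ∀ x ∈ W, ∀ y ∈ W, F.data.f x y = 0 := by
  cases F with
  | symplectic B alt => simp [IsTotallySingular, data]
  | quadratic Q =>
    simp only [IsTotallySingular, data]
    refine ⟨fun h => ⟨h, fun x hx y hy => ?_⟩, fun h => h.1⟩
    rw [QuadraticMap.polarBilin_apply_apply, QuadraticMap.polar, h _ (W.add_mem hx hy), h x hx,
      h y hy]
    simp
  | hermitian σ hσ hσ' B symm =>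
    simp only [IsTotallySingular, data]
    exact ⟨fun h => ⟨fun x hx => h x hx x hx, h⟩, fun h => h.2⟩

end PolarForm

namespace PolarData

variable {K V : Type*} [Field K] [AddCommGroup V] [Module K V] (E : PolarData K V)

lemma comm {x y : V} : E.f x y = 0 ↔ E.f y x = 0 := ⟨E.symm x y, E.symm y x⟩

/-- Totally singular subspaces. -/
def TS (W : Submodule K V) : Prop := (∀ x ∈ W, E.S x) ∧ ∀ x ∈ W, ∀ y ∈ W, E.f x y = 0

lemma add_smul_mem {x y : V} (hx : E.S x) (hy : E.S y) (h : E.f x y = 0) (c : K) :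
    E.S (x + c • y) :=
  E.add _ _ hx (E.smul c y hy) (by rw [map_smul, h, smul_zero])

/-- Orthogonality to a set passes to its span, by symmetry. -/
lemma f_eq_zero_of_mem_span {A : Set V} {w a : V} (h : ∀ a ∈ A, E.f a w = 0)
    (ha : a ∈ Submodule.span K A) : E.f a w = 0 := by
  apply E.symm
  have : Submodule.span K A ≤ LinearMap.ker (E.f w) :=
    Submodule.span_le.2 fun b hb => E.symm _ _ (h b hb)
  exact this ha

lemma f_add_left {x y w : V} (hx : E.f x w = 0) (hy : E.f y w = 0) : E.f (x + y) w = 0 := by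
  rw [E.comm, map_add, E.symm _ _ hx, E.symm _ _ hy, add_zero]

lemma f_smul_left {x w : V} (c : K) (hx : E.f x w = 0) : E.f (c • x) w = 0 := by
  rw [E.comm, map_smul, E.symm _ _ hx, smul_zero]

lemma TS_span {A : Set V} (hS : ∀ a ∈ A, E.S a) (hf : ∀ a ∈ A, ∀ b ∈ A, E.f a b = 0) :
    E.TS (Submodule.span K A) := by
  have hperp : ∀ x ∈ Submodule.span K A, ∀ y ∈ Submodule.span K A, E.f x y = 0 := by
    intro x hx y hy
    refine E.f_eq_zero_of_mem_span (fun a ha => ?_) hx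
    exact E.symm _ _ (E.f_eq_zero_of_mem_span (fun b hb => hf b hb a ha) hy)
  refine ⟨fun x hx => ?_, hperp⟩
  induction hx using Submodule.span_induction with
  | mem x h => exact hS x h
  | zero => exact E.S_zero
  | add x y hx hy h1 h2 => exact E.add _ _ h1 h2 (hperp x hx y hy)
  | smul c x _ h => exact E.smul c x h

/-- The singular vectors orthogonal to all of `A`. -/
def residue (A : Set V) : Set V := {w | E.S w ∧ ∀ a ∈ A, E.f a w = 0}

lemma residue_add_smul {A : Set V} {w v : V} (hw : w ∈ E.residue A) (hv : v ∈ E.residue A)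
    (h : E.f w v = 0) (c : K) : w + c • v ∈ E.residue A :=
  ⟨E.add_smul_mem hw.1 hv.1 h c, fun a ha => by
    rw [map_add, map_smul, hw.2 a ha, hv.2 a ha, smul_zero, add_zero]⟩

/-- Projecting `v^⊥` along `v` to `v^⊥ ∩ v'^⊥`: for nonorthogonal `v` and `v'`, each singular
vector orthogonal to both has exactly `|K|` preimages. -/
lemma card_perp_eq_mul {A : Set V} {v v' : V} (hv : v ∈ E.residue A) (hvv : E.f v v' ≠ 0) :
    Nat.card {w // w ∈ E.residue A ∧ E.f v w = 0} =
      Nat.card {w // w ∈ E.residue A ∧ E.f v w = 0 ∧ E.f v' w = 0} * Nat.card K := by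
  rw [← Nat.card_prod]
  have hvv' : E.f v' v ≠ 0 := fun h => hvv (E.symm _ _ h)
  refine Nat.card_congr
    { toFun := fun w => ⟨⟨w.1 + (-(E.f v' w.1 / E.f v' v)) • v,
        E.residue_add_smul w.2.1 hv (E.symm _ _ w.2.2) _, ?_, ?_⟩, E.f v' w.1 / E.f v' v⟩
      invFun := fun p => ⟨p.1.1 + p.2 • v,
        E.residue_add_smul p.1.2.1 hv (E.symm _ _ p.1.2.2.1) _, ?_⟩
      left_inv := ?_
      right_inv := ?_ }
  · rw [map_add, map_smul, w.2.2, E.self v hv.1, smul_zero, add_zero]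
  · rw [map_add, map_smul, smul_eq_mul]; field_simp; ring
  · rw [map_add, map_smul, p.1.2.2.1, E.self v hv.1, smul_zero, add_zero]
  · intro w
    ext1
    simp
  · rintro ⟨⟨w, h1, h2, h3⟩, t⟩
    have : E.f v' (w + t • v) / E.f v' v = t := by
      rw [map_add, map_smul, h3, zero_add, smul_eq_mul, mul_div_cancel_right₀ _ hvv']
    ext1
    · ext1
      simp only [this]
      simp
    · exact this

lemma card_perp_eq {A : Set V} {v v' : V} (hv : v ∈ E.residue A) (hv' : v' ∈ E.residue A)
    (hvv : E.f v v' ≠ 0) :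
    Nat.card {w // w ∈ E.residue A ∧ E.f v w = 0} =
      Nat.card {w // w ∈ E.residue A ∧ E.f v' w = 0} := by
  rw [E.card_perp_eq_mul hv hvv, E.card_perp_eq_mul hv' (fun h => hvv (E.symm _ _ h))]
  simp only [and_comm (a := E.f v _ = 0)]

/-- Any two vectors outside the radical of a residue are joined by a path of at most three
nonorthogonal steps, so the same number of singular vectors is orthogonal to each of them. -/
lemma card_perp_const {A : Set V} {v₁ v₂ : V} (h1 : v₁ ∈ E.residue A) (h2 : v₂ ∈ E.residue A)
    (h1' : ∃ u ∈ E.residue A, E.f v₁ u ≠ 0) (h2' : ∃ u ∈ E.residue A, E.f v₂ u ≠ 0) :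
    Nat.card {w // w ∈ E.residue A ∧ E.f v₁ w = 0} =
      Nat.card {w // w ∈ E.residue A ∧ E.f v₂ w = 0} := by
  obtain ⟨u₁, hu₁, k1⟩ := h1'
  obtain ⟨u₂, hu₂, k2⟩ := h2'
  by_cases a : E.f v₂ u₁ = 0
  swap
  · rw [E.card_perp_eq h1 hu₁ k1, E.card_perp_eq h2 hu₁ a]
  by_cases b : E.f v₁ u₂ = 0
  swap
  · rw [E.card_perp_eq h1 hu₂ b, E.card_perp_eq h2 hu₂ k2]
  by_cases c : E.f u₁ u₂ = 0
  swap
  · rw [E.card_perp_eq h1 hu₁ k1, E.card_perp_eq hu₁ hu₂ c, E.card_perp_eq h2 hu₂ k2]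
  have hu := E.residue_add_smul hu₁ hu₂ c 1
  rw [one_smul] at hu
  rw [E.card_perp_eq h1 hu (by rwa [map_add, b, add_zero]),
    E.card_perp_eq h2 hu (by rwa [map_add, a, zero_add])]

/-- No nonzero singular vector is orthogonal to all singular vectors. -/
def Nondeg : Prop := ∀ v, v ≠ 0 → E.S v → ∃ w, E.S w ∧ E.f v w ≠ 0

/-- Residues of nondegenerate polar spaces are nondegenerate: if `s ∪ {b}` spans a totally singular
subspace and `b` is not in the span of `s`, then some singular vector is orthogonal to `s` but
not to `b`. -/
lemma exists_perp_not_perp (hE : E.Nondeg) (s : Finset V) : ∀ b, b ∉ Submodule.span K (s : Set V) →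
    (∀ a ∈ s, E.S a) → (∀ a ∈ s, ∀ a' ∈ s, E.f a a' = 0) → E.S b → (∀ a ∈ s, E.f a b = 0) →
    ∃ w ∈ E.residue (s : Set V), E.f b w ≠ 0 := by
  classical
  induction s using Finset.induction_on with
  | empty =>
    intro b hb _ _ hS _
    obtain ⟨w, hw, hbw⟩ := hE b (by rintro rfl; simp at hb) hS
    exact ⟨w, ⟨hw, by simp⟩, hbw⟩
  | insert a s ha ih =>
    intro b hb hsS hsf hbS hbf
    have hsS' : ∀ c ∈ s, E.S c := fun c hc => hsS c (Finset.mem_insert_of_mem hc)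
    have hsf' : ∀ c ∈ s, ∀ d ∈ s, E.f c d = 0 := fun c hc d hd =>
      hsf c (Finset.mem_insert_of_mem hc) d (Finset.mem_insert_of_mem hd)
    have hsub : Submodule.span K (s : Set V) ≤ Submodule.span K (insert a s : Finset V) :=
      Submodule.span_mono (by simp)
    have haS := hsS a (Finset.mem_insert_self _ _)
    have haf : ∀ c ∈ s, E.f c a = 0 := fun c hc =>
      hsf c (Finset.mem_insert_of_mem hc) a (Finset.mem_insert_self _ _)
    have hab : E.f a b = 0 := hbf a (Finset.mem_insert_self _ _)
    have hbf' : ∀ c ∈ s, E.f c b = 0 := fun c hc => hbf c (Finset.mem_insert_of_mem hc)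
    have hins : ∀ w, w ∈ E.residue (s : Set V) → E.f a w = 0 →
        w ∈ E.residue ((insert a s : Finset V) : Set V) := by
      intro w hw haw
      refine ⟨hw.1, fun c hc => ?_⟩
      rcases Finset.mem_insert.1 (Finset.mem_coe.1 hc) with rfl | hc
      · exact haw
      · exact hw.2 c hc
    obtain ⟨w₁, hw₁, hbw₁⟩ := ih b (fun h => hb (hsub h)) hsS' hsf' hbS hbf'
    by_cases haw₁ : E.f a w₁ = 0
    · exact ⟨w₁, hins w₁ hw₁ haw₁, hbw₁⟩
    -- Replace `b` by the vector `b'` of the coset `b + ⟨a⟩` that is orthogonal to `w₁`.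
    have hw₁a : E.f w₁ a ≠ 0 := fun h => haw₁ (E.symm _ _ h)
    set c := -(E.f w₁ b / E.f w₁ a) with hc
    set b' := b + c • a with hb'
    have hw₁b' : E.f w₁ b' = 0 := by
      rw [hb', map_add, map_smul, smul_eq_mul, hc]; field_simp; ring
    have hab' : E.f a b' = 0 := by
      rw [hb', map_add, map_smul, hab, E.self a haS, smul_zero, add_zero]
    have hb'S : E.S b' := E.add_smul_mem hbS haS (E.symm _ _ hab) c
    have hb'f : ∀ d ∈ s, E.f d b' = 0 := fun d hd => by
      rw [hb', map_add, map_smul, hbf' d hd, haf d hd, smul_zero, add_zero]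
    have hb'n : b' ∉ Submodule.span K ((insert a s : Finset V) : Set V) := by
      intro h
      apply hb
      have := Submodule.sub_mem _ h (Submodule.smul_mem _ c
        (Submodule.subset_span (s := ((insert a s : Finset V) : Set V)) (by simp : a ∈ _)))
      rwa [hb', add_sub_cancel_right] at this
    -- It suffices to be orthogonal to `s` and `a`, but not to `b'`.
    suffices h : ∃ w ∈ E.residue (s : Set V), E.f a w = 0 ∧ E.f b' w ≠ 0 by
      obtain ⟨w, hw, haw, hbw⟩ := h
      refine ⟨w, hins w hw haw, fun h0 => hbw ?_⟩
      exact E.f_add_left h0 (E.f_smul_left c haw)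
    obtain ⟨w₂, hw₂, hbw₂⟩ := ih b' (fun h => hb'n (hsub h)) hsS' hsf' hb'S hb'f
    by_cases haw₂ : E.f a w₂ = 0
    · exact ⟨w₂, hw₂, haw₂, hbw₂⟩
    -- Move `w₂` along a vector `p` of `⟨a, b'⟩` orthogonal to it, so as to become orthogonal
    -- to `w₁`; then a combination of `w₁` and `w₂` is orthogonal to `a`.
    have hw₂b' : E.f w₂ b' ≠ 0 := fun h => hbw₂ (E.symm _ _ h)
    set p := E.f w₂ b' • a + (-(E.f w₂ a)) • b' with hp
    have hpS : E.S p := E.add_smul_mem (E.smul _ _ haS) hb'S (E.f_smul_left _ hab') _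
    have hw₂p : E.f w₂ p = 0 := by
      rw [hp, map_add, map_smul, map_smul, smul_eq_mul, smul_eq_mul]; ring
    have hw₁p : E.f w₁ p ≠ 0 := by
      rw [hp, map_add, map_smul, map_smul, hw₁b', smul_zero, add_zero, smul_eq_mul]
      exact mul_ne_zero hw₂b' hw₁a
    have hpf : ∀ d ∈ s, E.f d p = 0 := fun d hd => by
      rw [hp, map_add, map_smul, map_smul, hb'f d hd, haf d hd, smul_zero, smul_zero, add_zero]
    have hap : E.f a p = 0 := by
      rw [hp, map_add, map_smul, map_smul, hab', E.self a haS, smul_zero, smul_zero, add_zero]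
    have hb'p : E.f b' p = 0 := by
      rw [hp, map_add, map_smul, map_smul, E.symm _ _ hab', E.self b' hb'S, smul_zero, smul_zero,
        add_zero]
    set t := -(E.f w₁ w₂ / E.f w₁ p) with ht
    set w₃ := w₂ + t • p with hw₃
    have hw₃r : w₃ ∈ E.residue (s : Set V) :=
      E.residue_add_smul hw₂ ⟨hpS, hpf⟩ hw₂p t
    have hw₁w₃ : E.f w₁ w₃ = 0 := by
      rw [hw₃, map_add, map_smul, smul_eq_mul, ht]; field_simp; ring
    have haw₃ : E.f a w₃ = E.f a w₂ := by rw [hw₃, map_add, map_smul, hap, smul_zero, add_zero]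
    have hbw₃ : E.f b' w₃ = E.f b' w₂ := by rw [hw₃, map_add, map_smul, hb'p, smul_zero, add_zero]
    refine ⟨w₃ + (-(E.f a w₃ / E.f a w₁)) • w₁,
      E.residue_add_smul hw₃r hw₁ (E.symm _ _ hw₁w₃) _, ?_, ?_⟩
    · rw [map_add, map_smul, smul_eq_mul]; field_simp; ring
    · rwa [map_add, map_smul, E.symm _ _ hw₁b', smul_zero, add_zero, hbw₃]

/-- The number of singular vectors orthogonal to two independent orthogonal singular vectors does
not depend on the choice of these vectors. -/
lemma card_perp_pair_const (hE : E.Nondeg) {u₁ v₁ u₂ v₂ : V}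
    (hu₁ : E.S u₁) (hv₁ : E.S v₁) (hu₂ : E.S u₂) (hv₂ : E.S v₂)
    (h1 : E.f u₁ v₁ = 0) (h2 : E.f u₂ v₂ = 0)
    (i1 : LinearIndependent K ![u₁, v₁]) (i2 : LinearIndependent K ![u₂, v₂]) :
    Nat.card {w // E.S w ∧ E.f u₁ w = 0 ∧ E.f v₁ w = 0} =
      Nat.card {w // E.S w ∧ E.f u₂ w = 0 ∧ E.f v₂ w = 0} := by
  have step : ∀ u v w, E.S u → E.S v → E.S w → E.f u v = 0 → E.f u w = 0 →
      LinearIndependent K ![u, v] → LinearIndependent K ![u, w] →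
      Nat.card {z // E.S z ∧ E.f u z = 0 ∧ E.f v z = 0} =
      Nat.card {z // E.S z ∧ E.f u z = 0 ∧ E.f w z = 0} := by
    intro u v w hu hv hw huv huw i j
    have key := E.card_perp_const (A := {u}) (v₁ := v) (v₂ := w)
      ⟨hv, by simpa using huv⟩ ⟨hw, by simpa using huw⟩ ?_ ?_
    · simpa [residue, and_assoc] using key
    · have := E.exists_perp_not_perp hE {u} v ?_ (by simpa using hu)
        (by simpa using E.self u hu) hv (by simpa using huv)
      · simpa using this
      · rw [Finset.coe_singleton, Submodule.mem_span_singleton]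
        rintro ⟨c, rfl⟩
        have := (LinearIndependent.pair_iff.1 i) c (-1) (by simp)
        simp at this
    · have := E.exists_perp_not_perp hE {u} w ?_ (by simpa using hu)
        (by simpa using E.self u hu) hw (by simpa using huw)
      · simpa using this
      · rw [Finset.coe_singleton, Submodule.mem_span_singleton]
        rintro ⟨c, rfl⟩
        have := (LinearIndependent.pair_iff.1 j) c (-1) (by simp)
        simp at this
  have swap : ∀ u v, Nat.card {z // E.S z ∧ E.f u z = 0 ∧ E.f v z = 0} =
      Nat.card {z // E.S z ∧ E.f v z = 0 ∧ E.f u z = 0} := by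
    intro u v; simp only [and_comm (a := E.f u _ = 0)]
  -- It suffices to find `w` orthogonal to and independent of both `u₁` and `u₂`.
  suffices h : ∃ w, E.S w ∧ E.f u₁ w = 0 ∧ E.f u₂ w = 0 ∧ LinearIndependent K ![u₁, w] ∧
      LinearIndependent K ![u₂, w] by
    obtain ⟨w, hw, a, b, j1, j2⟩ := h
    have j1' := LinearIndependent.pair_symm_iff.1 j1
    have j2' := LinearIndependent.pair_symm_iff.1 j2
    rw [step u₁ v₁ w hu₁ hv₁ hw h1 a i1 j1, swap,
      step w u₁ u₂ hw hu₁ hu₂ (E.symm _ _ a) (E.symm _ _ b) j1' j2', swap,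
      step u₂ w v₂ hu₂ hw hv₂ b h2 j2 i2]
  have hu₁0 : u₁ ≠ 0 := i1.ne_zero 0
  have hu₂0 : u₂ ≠ 0 := i2.ne_zero 0
  by_cases hd : LinearIndependent K ![u₁, u₂]
  · by_cases h12 : E.f u₁ u₂ = 0
    · refine ⟨u₁ + u₂, E.add _ _ hu₁ hu₂ h12, ?_, ?_, ?_, ?_⟩
      · rw [map_add, E.self u₁ hu₁, h12, add_zero]
      · rw [map_add, E.self u₂ hu₂, E.symm _ _ h12, add_zero]
      · rw [LinearIndependent.pair_iff] at hd ⊢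
        intro s t hst
        obtain ⟨a, b⟩ := hd (s + t) t (by rw [← hst]; module)
        subst b; simpa using a
      · rw [LinearIndependent.pair_iff] at hd ⊢
        intro s t hst
        obtain ⟨a, b⟩ := hd t (s + t) (by rw [← hst]; module)
        subst a; simpa using b
    · have h21 : E.f u₂ u₁ ≠ 0 := fun h => h12 (E.symm _ _ h)
      set w := v₁ + (-(E.f u₂ v₁ / E.f u₂ u₁)) • u₁ with hw
      have hw2 : E.f u₂ w = 0 := by
        rw [hw, map_add, map_smul, smul_eq_mul]; field_simp; ring
      have hw1 : E.f u₁ w = 0 := by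
        rw [hw, map_add, map_smul, h1, E.self u₁ hu₁, smul_zero, add_zero]
      have hj : LinearIndependent K ![u₁, w] := by
        rw [LinearIndependent.pair_iff] at i1 ⊢
        intro s t hst
        obtain ⟨a, b⟩ := i1 (s + t * (-(E.f u₂ v₁ / E.f u₂ u₁))) t
          (by rw [← hst, hw]; module)
        subst b; simpa using a
      refine ⟨w, E.add_smul_mem hv₁ hu₁ (E.symm _ _ h1) _, hw1, hw2, hj, ?_⟩
      rw [LinearIndependent.pair_iff' hu₂0]
      intro a haw
      rw [← haw, map_smul, smul_eq_mul, mul_eq_zero] at hw1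
      rcases hw1 with h | h
      · exact hj.ne_zero 1 (by simp [← haw, h])
      · exact h12 h
  · rw [LinearIndependent.pair_iff' hu₁0] at hd
    push Not at hd
    obtain ⟨a, rfl⟩ := hd
    have ha : a ≠ 0 := by rintro rfl; simp at hu₂0
    refine ⟨v₁, hv₁, h1, E.f_smul_left a h1, i1, ?_⟩
    rw [LinearIndependent.pair_iff] at i1 ⊢
    intro s t hst
    obtain ⟨h, h'⟩ := i1 (s * a) t (by rw [← hst]; module)
    exact ⟨(mul_eq_zero.1 h).resolve_right ha, h'⟩

end PolarData

/-! ### Counting points -/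

open scoped LinearAlgebra.Projectivization

/-- If the vectors `r t` represent each one-dimensional subspace inside the cone `p` exactly once,
then the cone has `|K| - 1` nonzero vectors for each such `t`. -/
lemma card_cone {K E T : Type*} [Field K] [AddCommGroup E] [Module K E] (r : T → E) (p : E → Prop)
    (hp : ∀ (c : K) v, c ≠ 0 → p v → p (c • v)) (hr : ∀ t, r t ≠ 0)
    (hsurj : ∀ v, v ≠ 0 → p v → ∃ t, ∃ c : K, v = c • r t)
    (hinj : ∀ t t' (c : K), r t = c • r t' → t = t') :
    Nat.card {v // v ≠ 0 ∧ p v} = Nat.card {t // p (r t)} * (Nat.card K - 1) := by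
  classical
  rw [← Nat.card_units, ← Nat.card_prod]
  symm
  refine Nat.card_eq_of_bijective
    (fun x : {t // p (r t)} × Kˣ => (⟨(x.2 : K) • r x.1.1,
      smul_ne_zero x.2.ne_zero (hr _), hp _ _ x.2.ne_zero x.1.2⟩ : {v // v ≠ 0 ∧ p v})) ⟨?_, ?_⟩
  · rintro ⟨⟨t, ht⟩, c⟩ ⟨⟨t', ht'⟩, c'⟩ h
    simp only [Subtype.mk.injEq] at h
    have h1 : r t = ((c : K)⁻¹ * c') • r t' := by
      rw [mul_smul, ← h, smul_smul, inv_mul_cancel₀ c.ne_zero, one_smul]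
    obtain rfl := hinj _ _ _ h1
    have h2 : (c : K) = c' := by
      have := sub_eq_zero.2 h
      rw [← sub_smul, smul_eq_zero] at this
      exact sub_eq_zero.1 (this.resolve_right (hr t))
    rw [Units.ext h2]
  · rintro ⟨v, hv, hpv⟩
    obtain ⟨t, c, rfl⟩ := hsurj v hv hpv
    have hc : c ≠ 0 := by rintro rfl; simp at hv
    refine ⟨⟨⟨t, ?_⟩, Units.mk0 c hc⟩, rfl⟩
    have := hp c⁻¹ _ (inv_ne_zero hc) hpv
    rwa [smul_smul, inv_mul_cancel₀ hc, one_smul] at this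

/-- The number of points of a projective space of vector space dimension `n` over a field with `q`
elements. -/
def gnum (q n : ℕ) : ℕ := ∑ i ∈ Finset.range n, q ^ i

lemma gnum_succ (q n : ℕ) : gnum q (n + 1) = gnum q n + q ^ n := Finset.sum_range_succ _ _

lemma gnum_succ' (q n : ℕ) : gnum q (n + 1) = q * gnum q n + 1 := by
  rw [gnum, Finset.sum_range_succ', gnum, Finset.mul_sum, pow_zero]
  simp_rw [pow_succ']

lemma gnum_mul (q n : ℕ) (hq : 1 ≤ q) : gnum q n * (q - 1) + 1 = q ^ n := by
  obtain ⟨r, rfl⟩ := Nat.exists_eq_add_of_le' hq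
  induction n with
  | zero => simp [gnum]
  | succ n ih =>
    rw [gnum_succ, pow_succ]
    simp only [Nat.add_sub_cancel] at ih ⊢
    rw [add_mul, add_right_comm, ih]; ring

lemma gnum_lt_gnum {q m n : ℕ} (hq : 1 ≤ q) (h : m < n) : gnum q m < gnum q n := by
  refine strictMono_nat_of_lt_succ (f := gnum q) (fun n => ?_) h
  rw [gnum_succ]
  exact Nat.lt_add_of_pos_right (by positivity)

section
variable {K E : Type*} [Field K] [AddCommGroup E] [Module K E]

lemma eq_gnum_of_mul [Finite K] {n c : ℕ} (h : c * (Nat.card K - 1) + 1 = Nat.card K ^ n) :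
    c = gnum (Nat.card K) n := by
  have h1 : 1 < Nat.card K := Finite.one_lt_card
  have := gnum_mul (Nat.card K) n h1.le
  exact Nat.eq_of_mul_eq_mul_right (by omega) (by omega : _ = gnum _ n * (Nat.card K - 1))

lemma card_submodule_ne_zero [Finite K] [FiniteDimensional K E] (W : Submodule K E) :
    Nat.card {v // v ≠ 0 ∧ v ∈ W} + 1 = Nat.card K ^ Module.finrank K W := by
  classical
  have : Finite E := Module.finite_of_finite K
  rw [← Module.natCard_eq_pow_finrank (K := K) (V := W)]
  have : Nat.card {v : W // v ≠ 0} = Nat.card {v // v ≠ 0 ∧ v ∈ W} := by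
    refine Nat.card_congr ⟨fun v => ⟨v.1.1, by simpa using v.2, v.1.2⟩,
      fun v => ⟨⟨v.1, v.2.2⟩, by simpa using v.2.1⟩, fun v => rfl, fun v => rfl⟩
  rw [← this]
  have := Nat.card_congr (Equiv.sumCompl (fun v : W => v ≠ 0))
  rw [Nat.card_sum] at this
  rw [← this]
  congr 1
  simp

lemma card_projectivization_mem [Finite K] [FiniteDimensional K E] (W : Submodule K E) :
    Nat.card {H : ℙ K E // H.rep ∈ W} = gnum (Nat.card K) (Module.finrank K W) := by
  refine eq_gnum_of_mul ?_
  rw [← card_submodule_ne_zero W, card_cone (fun H : ℙ K E => H.rep) (· ∈ W)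
    (fun c v _ => W.smul_mem c) (fun H => H.rep_nonzero) ?_ ?_]
  · intro v hv _
    obtain ⟨a, ha⟩ := Projectivization.exists_smul_eq_mk_rep K v hv
    exact ⟨Projectivization.mk K v hv, ((a⁻¹ : Kˣ) : K), by
      rw [← ha, Units.smul_def, smul_smul, Units.inv_mul, one_smul]⟩
  · intro t t' c h
    rw [← t.mk_rep, ← t'.mk_rep, Projectivization.mk_eq_mk_iff']
    exact ⟨c, h.symm⟩

lemma finrank_ker_inf_ker [FiniteDimensional K E] {g g' : Module.Dual K E} (hg : g ≠ 0)
    (hg' : ∀ c : K, c • g ≠ g') :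
    Module.finrank K (LinearMap.ker g ⊓ LinearMap.ker g' : Submodule K E) + 2 =
      Module.finrank K E := by
  have h1 := Module.Dual.finrank_ker_add_one_of_ne_zero hg
  have hne : g'.domRestrict (LinearMap.ker g) ≠ 0 := by
    intro h
    have hle : ⨅ i : Unit, LinearMap.ker ((fun _ => g) i) ≤ LinearMap.ker g' := by
      rw [iInf_const]
      intro v hv
      exact LinearMap.congr_fun h ⟨v, hv⟩
    have := mem_span_of_iInf_ker_le_ker hle
    rw [Set.range_const, Submodule.mem_span_singleton] at this
    obtain ⟨c, hc⟩ := this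
    exact hg' c hc
  have h2 := Module.Dual.finrank_ker_add_one_of_ne_zero (f := g'.domRestrict (LinearMap.ker g)) hne
  have h3 : Submodule.map (LinearMap.ker g).subtype
      (LinearMap.ker (g'.domRestrict (LinearMap.ker g))) =
      LinearMap.ker g ⊓ LinearMap.ker g' := by
    ext v
    simp only [Submodule.mem_map, LinearMap.mem_ker, Submodule.mem_inf, Submodule.subtype_apply,
      LinearMap.domRestrict_apply]
    constructor
    · rintro ⟨w, hw, rfl⟩; exact ⟨w.2, hw⟩
    · rintro ⟨a, b⟩; exact ⟨⟨v, a⟩, b, rfl⟩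
  rw [← h3, ← (Submodule.equivMapOfInjective _ (Submodule.injective_subtype _) _).finrank_eq]
  omega
end

namespace PolarForm

variable {K V : Type*} [Field K] [AddCommGroup V] [Module K V] (F : PolarForm K V)

lemma exists_vec (x : F.Point) : ∃ v, v ≠ 0 ∧ F.data.S v ∧ x.1 = Submodule.span K {v} := by
  obtain ⟨⟨v, hv⟩, hv0, h⟩ := finrank_eq_one_iff'.1 x.2.1
  refine ⟨v, by simpa using hv0, ((F.isTotallySingular_iff _).1 x.2.2).1 v hv, ?_⟩
  apply le_antisymm
  · intro w hw
    obtain ⟨c, hc⟩ := h ⟨w, hw⟩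
    rw [Submodule.mem_span_singleton]
    exact ⟨c, congrArg Subtype.val hc⟩
  · rw [Submodule.span_le]; simpa using hv

variable {F} in
/-- A vector spanning a point. -/
noncomputable def Point.vec (x : F.Point) : V := (F.exists_vec x).choose

variable {F} in
lemma Point.vec_ne (x : F.Point) : x.vec ≠ 0 := (F.exists_vec x).choose_spec.1

variable {F} in
lemma Point.vec_S (x : F.Point) : F.data.S x.vec := (F.exists_vec x).choose_spec.2.1

variable {F} in
lemma Point.eq_span (x : F.Point) : x.1 = Submodule.span K {x.vec} :=
  (F.exists_vec x).choose_spec.2.2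

variable {F} in
lemma Point.vec_mem (x : F.Point) : x.vec ∈ x.1 := by
  rw [x.eq_span]; exact Submodule.mem_span_singleton_self _

variable {F} in
lemma Point.le_iff (x : F.Point) (W : Submodule K V) : x.1 ≤ W ↔ x.vec ∈ W := by
  rw [x.eq_span, Submodule.span_singleton_le_iff_mem]

variable {F} in
/-- The point spanned by a nonzero singular vector. -/
def Point.mk' (v : V) (hv : v ≠ 0) (hS : F.data.S v) : F.Point :=
  ⟨Submodule.span K {v}, finrank_span_singleton hv, by
    rw [F.isTotallySingular_iff]
    exact F.data.TS_span (by simpa using hS) (by simpa using F.data.self v hS)⟩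

variable {F} in
lemma Point.vec_mk' (v : V) (hv : v ≠ 0) (hS : F.data.S v) :
    ∃ c : K, c ≠ 0 ∧ (Point.mk' v hv hS).vec = c • v := by
  have := (Point.mk' v hv hS).vec_mem
  obtain ⟨c, hc⟩ := Submodule.mem_span_singleton.1 this
  refine ⟨c, ?_, hc.symm⟩
  rintro rfl
  exact (Point.mk' v hv hS).vec_ne (by rw [← hc, zero_smul])

variable {F} in
lemma Point.eq_of_vec_eq {x y : F.Point} {c : K} (h : x.vec = c • y.vec) : x = y := by
  have hc : c ≠ 0 := by rintro rfl; exact x.vec_ne (by rw [h, zero_smul])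
  apply Subtype.ext
  rw [x.eq_span, y.eq_span, h, Submodule.span_singleton_smul_eq (IsUnit.mk0 c hc)]

variable {F} in
lemma Point.linearIndependent {x y : F.Point} (h : x ≠ y) :
    LinearIndependent K ![x.vec, y.vec] := by
  rw [LinearIndependent.pair_iff' x.vec_ne]
  exact fun a ha => h (Point.eq_of_vec_eq ha.symm).symm

variable {F} in
/-- Orthogonality of points. -/
def Point.Perp (x y : F.Point) : Prop := F.data.f x.vec y.vec = 0

variable {F} in
lemma Point.Perp.symm {x y : F.Point} (h : x.Perp y) : y.Perp x := F.data.symm _ _ h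

variable {F} in
lemma Point.perp_self (x : F.Point) : x.Perp x := F.data.self _ x.vec_S

variable {F} in
lemma Point.perp_mk' {x : F.Point} {v : V} (hv : v ≠ 0) (hS : F.data.S v) :
    x.Perp (Point.mk' v hv hS) ↔ F.data.f x.vec v = 0 := by
  obtain ⟨c, hc, h⟩ := Point.vec_mk' v hv hS
  rw [Point.Perp, h, map_smul, smul_eq_mul, mul_eq_zero, or_iff_right hc]

lemma adj_iff {x y : F.Point} : F.collinearityGraph.Adj x y ↔ x ≠ y ∧ x.Perp y := by
  refine and_congr_right fun hne => ⟨?_, fun h => ?_⟩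
  · rintro ⟨L, ⟨_, hL⟩, hx, hy⟩
    exact ((F.isTotallySingular_iff _).1 hL).2 _ (hx x.vec_mem) _ (hy y.vec_mem)
  · refine ⟨Submodule.span K {x.vec, y.vec}, ⟨?_, ?_⟩, ?_, ?_⟩
    · have := finrank_span_eq_card (Point.linearIndependent hne)
      rwa [Matrix.range_cons, Matrix.range_cons, Matrix.range_empty, Set.union_empty,
        Set.singleton_union] at this
    · rw [F.isTotallySingular_iff]
      refine F.data.TS_span ?_ ?_
      · rintro a (rfl | rfl)
        · exact x.vec_S
        · exact y.vec_S
      · rintro a (rfl | rfl) b (rfl | rfl)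
        · exact x.perp_self
        · exact h
        · exact h.symm
        · exact y.perp_self
    · rw [x.le_iff]; exact Submodule.subset_span (by simp)
    · rw [y.le_iff]; exact Submodule.subset_span (by simp)

lemma nondeg (hF : F.IsNondegenerate) : F.data.Nondeg := by
  intro v hv hS
  obtain ⟨y, hne, hy⟩ := hF (Point.mk' v hv hS)
  rw [adj_iff, not_and] at hy
  refine ⟨y.vec, y.vec_S, fun h => hy hne ?_⟩
  exact Point.Perp.symm ((Point.perp_mk' hv hS).2 (F.data.symm _ _ h))

lemma card_points_mul (p : V → Prop) (hp : ∀ (c : K) v, c ≠ 0 → p v → p (c • v)) :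
    Nat.card {v // v ≠ 0 ∧ F.data.S v ∧ p v} =
      Nat.card {x : F.Point // p x.vec} * (Nat.card K - 1) := by
  rw [card_cone (K := K) (fun x : F.Point => x.vec) (fun v => F.data.S v ∧ p v)
    (fun c v hc h => ⟨F.data.smul c v h.1, hp c v hc h.2⟩) (fun x => x.vec_ne) ?_
    (fun x y c h => Point.eq_of_vec_eq h)]
  · congr 1
    exact Nat.card_congr (Equiv.subtypeEquivRight fun x => ⟨fun h => h.2, fun h => ⟨x.vec_S, h⟩⟩)
  · rintro v hv ⟨hS, _⟩
    obtain ⟨c, hc, h⟩ := Point.vec_mk' v hv hS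
    exact ⟨Point.mk' v hv hS, c⁻¹, by rw [h, smul_smul, inv_mul_cancel₀ hc, one_smul]⟩

section counting
variable [Finite K] [FiniteDimensional K V]

/-- The number of points of a cone is determined by its number of singular vectors. -/
lemma card_points_congr {p p' : V → Prop} (hp : ∀ (c : K) v, p v → p (c • v))
    (hp' : ∀ (c : K) v, p' v → p' (c • v)) (h0 : p 0) (h0' : p' 0)
    (h : Nat.card {v // F.data.S v ∧ p v} = Nat.card {v // F.data.S v ∧ p' v}) :
    Nat.card {x : F.Point // p x.vec} = Nat.card {x : F.Point // p' x.vec} := by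
  classical
  have : Finite V := Module.finite_of_finite K
  have key : ∀ r : V → Prop, r 0 → Nat.card {v // F.data.S v ∧ r v} =
      Nat.card {v // v ≠ 0 ∧ F.data.S v ∧ r v} + 1 := by
    intro r hr
    have := Nat.card_congr (Equiv.sumCompl (fun v : {v // F.data.S v ∧ r v} => v.1 ≠ 0))
    rw [Nat.card_sum] at this
    rw [← this]
    congr 1
    · exact Nat.card_congr ⟨fun v => ⟨v.1.1, v.2, v.1.2⟩, fun v => ⟨⟨v.1, v.2.2⟩, v.2.1⟩,
        fun v => rfl, fun v => rfl⟩
    · rw [Nat.card_eq_one_iff_unique]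
      refine ⟨⟨fun a b => ?_⟩, ⟨⟨0, F.data.S_zero, hr⟩, by simp⟩⟩
      ext
      rw [not_not.1 a.2, not_not.1 b.2]
  rw [key p h0, key p' h0', F.card_points_mul p (fun c v _ => hp c v),
    F.card_points_mul p' (fun c v _ => hp' c v)] at h
  have h1 : 1 < Nat.card K := Finite.one_lt_card
  exact Nat.eq_of_mul_eq_mul_right (by omega) (Nat.add_right_cancel h)

lemma card_points_le {W : Submodule K V} (hW : F.data.TS W) :
    Nat.card {x : F.Point // x.vec ∈ W} = gnum (Nat.card K) (Module.finrank K W) := by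
  refine eq_gnum_of_mul ?_
  rw [← F.card_points_mul (· ∈ W) (fun c v _ => W.smul_mem c), ← card_submodule_ne_zero W]
  congr 1
  exact Nat.card_congr (Equiv.subtypeEquivRight fun x =>
    ⟨fun h => ⟨h.1, h.2.2⟩, fun h => ⟨h.1, hW.1 _ h.2, h.2⟩⟩)

end counting

end PolarForm

namespace PolarForm

variable {K V : Type*} [Field K] [AddCommGroup V] [Module K V] (F : PolarForm K V)

/-! ### The collinearity graph is strongly regular -/

open Classical in
lemma card_filter_adj [Fintype F.Point] (x : F.Point) :
    (Finset.univ.filter fun z => F.collinearityGraph.Adj x z).card =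
      Nat.card {z : F.Point // F.data.f x.vec z.vec = 0} - 1 := by
  rw [Nat.card_eq_fintype_card, Fintype.card_subtype,
    ← Finset.card_erase_of_mem (a := x)
      (s := Finset.univ.filter fun z : F.Point => F.data.f x.vec z.vec = 0)
      (Finset.mem_filter.2 ⟨Finset.mem_univ _, x.perp_self⟩)]
  congr 1
  ext z
  simp only [Finset.mem_filter, Finset.mem_univ, true_and, Finset.mem_erase, adj_iff, ne_comm]
  rfl

open Classical in
lemma card_filter_adj_adj [Fintype F.Point] {x y : F.Point} (h : F.collinearityGraph.Adj x y) :
    (Finset.univ.filter fun z => F.collinearityGraph.Adj x z ∧ F.collinearityGraph.Adj y z).card =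
      Nat.card {z : F.Point // F.data.f x.vec z.vec = 0 ∧ F.data.f y.vec z.vec = 0} - 1 - 1 := by
  rw [F.adj_iff] at h
  rw [Nat.card_eq_fintype_card, Fintype.card_subtype,
    ← Finset.card_erase_of_mem (a := x) (Finset.mem_filter.2 ⟨Finset.mem_univ _, x.perp_self, h.2.symm⟩),
    ← Finset.card_erase_of_mem (a := y)
      (Finset.mem_erase.2 ⟨h.1.symm, Finset.mem_filter.2 ⟨Finset.mem_univ _, h.2, y.perp_self⟩⟩)]
  congr 1
  ext z
  simp only [Finset.mem_filter, Finset.mem_univ, true_and, Finset.mem_erase, adj_iff, ne_comm,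
    Point.Perp]
  tauto

open Classical in
lemma card_filter_nonadj [Fintype F.Point] {x y : F.Point} (hne : x ≠ y)
    (h : ¬ F.collinearityGraph.Adj x y) :
    (Finset.univ.filter fun z => F.collinearityGraph.Adj x z ∧ F.collinearityGraph.Adj y z).card =
      Nat.card {z : F.Point // F.data.f x.vec z.vec = 0 ∧ F.data.f y.vec z.vec = 0} := by
  rw [F.adj_iff, not_and] at h
  have h := h hne
  rw [Nat.card_eq_fintype_card, Fintype.card_subtype]
  congr 1
  ext z
  simp only [Finset.mem_filter, Finset.mem_univ, true_and, adj_iff, Point.Perp]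
  refine ⟨fun k => ⟨k.1.2, k.2.2⟩, fun k => ⟨⟨?_, k.1⟩, ?_, k.2⟩⟩
  · rintro rfl; exact h (Point.Perp.symm k.2)
  · rintro rfl; exact h k.1

/-- A function that takes equal values at any two arguments satisfying `p` is constant on `p`. -/
lemma exists_const {α : Type*} {p : α → Prop} {g : α → ℕ}
    (h : ∀ a b, p a → p b → g a = g b) : ∃ c, ∀ a, p a → g a = c := by
  by_cases hp : ∃ a, p a
  · obtain ⟨a, ha⟩ := hp
    exact ⟨g a, fun b hb => h b a hb ha⟩
  · exact ⟨0, fun a ha => absurd ⟨a, ha⟩ hp⟩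

lemma exists_hasSRGCounts [Finite K] [FiniteDimensional K V] [Fintype F.Point] (hF : F.data.Nondeg) :
    ∃ k l μ, HasSRGCounts F.collinearityGraph k l μ := by
  classical
  set E := F.data with hE
  have hsm1 : ∀ (u : V) (c : K) v, E.f u v = 0 → E.f u (c • v) = 0 := by
    intro u c v h; rw [map_smul, h, smul_zero]
  have hsm2 : ∀ (u u' : V) (c : K) v, E.f u v = 0 ∧ E.f u' v = 0 →
      E.f u (c • v) = 0 ∧ E.f u' (c • v) = 0 := by
    intro u u' c v h; exact ⟨hsm1 _ _ _ h.1, hsm1 _ _ _ h.2⟩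
  have hrad : ∀ x : F.Point, ∃ u ∈ E.residue ∅, E.f x.vec u ≠ 0 := by
    intro x
    obtain ⟨w, hw, h⟩ := hF x.vec x.vec_ne x.vec_S
    exact ⟨w, ⟨hw, by simp⟩, h⟩
  have hmem : ∀ x : F.Point, x.vec ∈ E.residue ∅ := fun x => ⟨x.vec_S, by simp⟩
  have hk : ∀ x y : F.Point, Nat.card {v // E.S v ∧ E.f x.vec v = 0} =
      Nat.card {v // E.S v ∧ E.f y.vec v = 0} := by
    intro x y
    have := E.card_perp_const (hmem x) (hmem y) (hrad x) (hrad y)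
    simpa [PolarData.residue] using this
  obtain ⟨k, hk'⟩ := exists_const (p := fun _ : F.Point => True)
    (g := fun x => (Finset.univ.filter fun z => F.collinearityGraph.Adj x z).card) (by
      intro x y _ _
      simp only [F.card_filter_adj]
      congr 1
      exact F.card_points_congr (p := fun v => E.f x.vec v = 0) (p' := fun v => E.f y.vec v = 0)
        (hsm1 _) (hsm1 _) (map_zero _) (map_zero _) (hk x y))
  obtain ⟨l, hl⟩ := exists_const
    (p := fun x : F.Point × F.Point => F.collinearityGraph.Adj x.1 x.2)
    (g := fun x => (Finset.univ.filter fun z =>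
      F.collinearityGraph.Adj x.1 z ∧ F.collinearityGraph.Adj x.2 z).card) (by
      rintro ⟨x, y⟩ ⟨x', y'⟩ h h'
      simp only [F.card_filter_adj_adj h, F.card_filter_adj_adj h']
      rw [F.adj_iff] at h h'
      congr 2
      refine F.card_points_congr (p := fun v => E.f x.vec v = 0 ∧ E.f y.vec v = 0)
        (p' := fun v => E.f x'.vec v = 0 ∧ E.f y'.vec v = 0)
        (hsm2 _ _) (hsm2 _ _) (by simp) (by simp) ?_
      exact E.card_perp_pair_const hF x.vec_S y.vec_S x'.vec_S y'.vec_S h.2 h'.2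
        (Point.linearIndependent h.1) (Point.linearIndependent h'.1))
  obtain ⟨μ, hμ⟩ := exists_const
    (p := fun x : F.Point × F.Point => x.1 ≠ x.2 ∧ ¬ F.collinearityGraph.Adj x.1 x.2)
    (g := fun x => (Finset.univ.filter fun z =>
      F.collinearityGraph.Adj x.1 z ∧ F.collinearityGraph.Adj x.2 z).card) (by
      rintro ⟨x, y⟩ ⟨x', y'⟩ h h'
      simp only [F.card_filter_nonadj h.1 h.2, F.card_filter_nonadj h'.1 h'.2]
      rw [F.adj_iff, not_and] at h h'
      refine F.card_points_congr (p := fun v => E.f x.vec v = 0 ∧ E.f y.vec v = 0)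
        (p' := fun v => E.f x'.vec v = 0 ∧ E.f y'.vec v = 0)
        (hsm2 _ _) (hsm2 _ _) (by simp) (by simp) ?_
      have h1 := hk x x'
      have e1 := E.card_perp_eq_mul (A := ∅) (hmem x) (h.2 h.1)
      have e2 := E.card_perp_eq_mul (A := ∅) (hmem x') (h'.2 h'.1)
      simp only [PolarData.residue, Set.mem_empty_iff_false, false_imp_iff, implies_true, and_true,
        Set.mem_ofPred_eq] at e1 e2
      rw [e1, e2] at h1
      exact Nat.eq_of_mul_eq_mul_right Nat.card_pos h1)
  exact ⟨k, l, μ, fun x => hk' x trivial, fun x y h => hl (x, y) h, fun x y h h' =>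
    hμ (x, y) ⟨h, h'⟩⟩

/-! ### Hyperplanes cut out on a generator -/

/-- A generator: a totally singular subspace `M` containing all singular vectors orthogonal to it.
-/
structure IsGenerator (M : Submodule K V) : Prop where
  ts : F.data.TS M
  mem : ∀ v, F.data.S v → (∀ a ∈ M, F.data.f a v = 0) → v ∈ M

lemma exists_generator [FiniteDimensional K V] {d : ℕ} (h : F.HasRank d) :
    ∃ M : Submodule K V, F.IsGenerator M ∧ Module.finrank K M = d := by
  obtain ⟨⟨M, hM, rfl⟩, hmax⟩ := h
  have hTS := (F.isTotallySingular_iff M).1 hM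
  refine ⟨M, ⟨hTS, fun v hv hperp => ?_⟩, rfl⟩
  by_contra hvM
  have hlt : M < Submodule.span K (insert v (M : Set V)) := by
    refine lt_of_le_of_ne (fun a ha => Submodule.subset_span (Set.mem_insert_of_mem _ ha)) ?_
    intro h
    exact hvM (h ▸ Submodule.subset_span (Set.mem_insert _ _))
  have h1 := Submodule.finrank_lt_finrank_of_lt hlt
  refine h1.not_ge (hmax ⟨_, ?_, rfl⟩)
  rw [F.isTotallySingular_iff]
  refine F.data.TS_span ?_ ?_
  · rintro a (rfl | ha)
    · exact hv
    · exact hTS.1 a ha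
  · rintro a (rfl | ha) b (rfl | hb)
    · exact F.data.self _ hv
    · exact F.data.symm _ _ (hperp b hb)
    · exact hperp a ha
    · exact hTS.2 a ha b hb

end PolarForm

namespace PolarForm

variable {K V : Type*} [Field K] [AddCommGroup V] [Module K V] (F : PolarForm K V)

/-- The hyperplane `x^⊥ ∩ M` of `M`, as a point of the projective space of the dual of `M`. The
value at points `x` orthogonal to `M` is arbitrary. -/
noncomputable def hyp (M : Submodule K V) [Nonempty (ℙ K (Module.Dual K M))] (x : F.Point) :
    ℙ K (Module.Dual K M) :=
  open Classical in
  if h : (F.data.f x.vec).domRestrict M ≠ 0 then Projectivization.mk K _ h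
  else Classical.arbitrary _

/-- The point `m` lies on the hyperplane `H` of `M`. -/
def Inc (M : Submodule K V) (m : F.Point) (H : ℙ K (Module.Dual K M)) : Prop :=
  ∀ a : M, (a : V) = m.vec → H.rep a = 0

variable {F} {M : Submodule K V}

lemma inc_iff {m : F.Point} (hm : m.vec ∈ M) {H : ℙ K (Module.Dual K M)} :
    F.Inc M m H ↔ H.rep ⟨m.vec, hm⟩ = 0 :=
  ⟨fun h => h _ rfl, fun h a ha => by rwa [show a = ⟨m.vec, hm⟩ from Subtype.ext ha]⟩

lemma _root_.Projectivization.eq_of_rep_eq_zero {E : Type*} [AddCommGroup E] [Module K E]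
    {H H' : ℙ K (Module.Dual K E)} (h : ∀ a, H.rep a = 0 → H'.rep a = 0) : H = H' := by
  have hle : ⨅ i : Unit, LinearMap.ker ((fun _ => H.rep) i) ≤ LinearMap.ker H'.rep := by
    rw [iInf_const]; exact h
  have := mem_span_of_iInf_ker_le_ker hle
  rw [Set.range_const, Submodule.mem_span_singleton] at this
  rw [← H.mk_rep, ← H'.mk_rep, eq_comm, Projectivization.mk_eq_mk_iff']
  exact this

lemma _root_.Projectivization.mem_span_pair_rep_iff {E : Type*} [AddCommGroup E] [Module K E]
    {H₁ H₂ H₃ : ℙ K (Module.Dual K E)} : H₃.rep ∈ Submodule.span K {H₁.rep, H₂.rep} ↔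
      ∀ a, H₁.rep a = 0 → H₂.rep a = 0 → H₃.rep a = 0 := by
  constructor
  · intro h a h1 h2
    obtain ⟨s, t, h⟩ := Submodule.mem_span_pair.1 h
    rw [← h]; simp [h1, h2]
  · intro h
    have hle : ⨅ i, LinearMap.ker ((![H₁.rep, H₂.rep]) i) ≤ LinearMap.ker H₃.rep := by
      intro a ha
      simp only [Submodule.mem_iInf, Fin.forall_fin_two, LinearMap.mem_ker, Matrix.cons_val_zero,
        Matrix.cons_val_one] at ha
      exact h a ha.1 ha.2
    have := mem_span_of_iInf_ker_le_ker hle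
    rwa [Matrix.range_cons, Matrix.range_cons, Matrix.range_empty, Set.union_empty,
        Set.singleton_union] at this

lemma exists_inc_not_inc {m m' : F.Point} (hm : m.vec ∈ M) (hm' : m'.vec ∈ M) (hne : m ≠ m') :
    ∃ H, F.Inc M m H ∧ ¬ F.Inc M m' H := by
  set a : M := ⟨m.vec, hm⟩
  set b : M := ⟨m'.vec, hm'⟩
  have hb : b ∉ Submodule.span K {a} := by
    rw [Submodule.mem_span_singleton]
    rintro ⟨c, hc⟩
    exact hne (Point.eq_of_vec_eq (c := c) (congrArg Subtype.val hc).symm).symm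
  obtain ⟨g, hg, hg'⟩ := Submodule.exists_le_ker_of_notMem hb
  have hg0 : g ≠ 0 := by rintro rfl; simp at hg
  obtain ⟨c, hc⟩ := Projectivization.exists_smul_eq_mk_rep K g hg0
  refine ⟨Projectivization.mk K g hg0, ?_, ?_⟩
  · rw [inc_iff hm, ← hc, Units.smul_def, LinearMap.smul_apply]
    rw [show g ⟨m.vec, hm⟩ = 0 from hg' (Submodule.mem_span_singleton_self a), smul_zero]
  · rw [inc_iff hm', ← hc, Units.smul_def, LinearMap.smul_apply, smul_eq_mul, mul_eq_zero, not_or]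
    exact ⟨c.ne_zero, hg⟩

/-- Points outside `M` suffice to recognize the line on two points outside `M` as a double
perp. -/
lemma mem_span_of_forall_perp (hF : F.data.Nondeg) {x y z : F.Point}
    (hx : x.vec ∉ M) (hy : y.vec ∉ M) (hxy : x.Perp y)
    (h : ∀ w : F.Point, w.vec ∉ M → w.Perp x → w.Perp y → w.Perp z) :
    z.vec ∈ Submodule.span K {x.vec, y.vec} := by
  classical
  by_contra hz
  have hxz : x.Perp z := h x hx x.perp_self hxy
  have hyz : y.Perp z := h y hy hxy.symm y.perp_self
  obtain ⟨w, ⟨hw, hws⟩, hzw⟩ := F.data.exists_perp_not_perp hF {x.vec, y.vec} z.vec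
    (by simpa using hz) (by simpa using ⟨x.vec_S, y.vec_S⟩)
    (by simpa using ⟨⟨x.perp_self, hxy⟩, hxy.symm, y.perp_self⟩) z.vec_S
    (by simpa using ⟨hxz, hyz⟩)
  have hwx : F.data.f x.vec w = 0 := hws _ (by simp)
  have hwy : F.data.f y.vec w = 0 := hws _ (by simp)
  have key : ∀ w, F.data.S w → w ∉ M → F.data.f x.vec w = 0 → F.data.f y.vec w = 0 →
      F.data.f z.vec w = 0 := by
    intro w hw hwM h1 h2
    have hw0 : w ≠ 0 := fun h => hwM (h ▸ M.zero_mem)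
    have hM' : (Point.mk' w hw0 hw).vec ∉ M := by
      obtain ⟨c, hc, hv⟩ := Point.vec_mk' w hw0 hw
      rwa [hv, M.smul_mem_iff hc]
    have := h _ hM' ((Point.perp_mk' hw0 hw).2 h1).symm ((Point.perp_mk' hw0 hw).2 h2).symm
    exact (Point.perp_mk' hw0 hw).1 this.symm
  by_cases hwM : w ∈ M
  · -- A vector of `M` is moved out of `M` by adding `x`.
    refine hzw ?_
    have := key (w + x.vec) (F.data.add _ _ hw x.vec_S (F.data.symm _ _ hwx))
      (fun h => hx ((M.add_mem_iff_right hwM).1 h))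
      (by rw [map_add, hwx, x.perp_self, add_zero]) (by rw [map_add, hwy, hxy.symm, add_zero])
    rwa [map_add, hxz.symm, add_zero] at this
  · exact hzw (key w hw hwM hwx hwy)

namespace IsGenerator

variable (hM : F.IsGenerator M)
include hM

lemma exists_inc_vec {a : M} (ha : a ≠ 0) :
    ∃ m : F.Point, ∃ hm : m.vec ∈ M, ∀ g : Module.Dual K M, g ⟨m.vec, hm⟩ = 0 ↔ g a = 0 := by
  have ha' : (a : V) ≠ 0 := by simpa using ha
  obtain ⟨c, hc, h⟩ := Point.vec_mk' (a : V) ha' (hM.ts.1 a a.2)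
  have hmem : (Point.mk' (a : V) ha' (hM.ts.1 a a.2)).vec ∈ M := by
    rw [h]; exact M.smul_mem c a.2
  refine ⟨_, hmem, fun g => ?_⟩
  rw [show (⟨_, hmem⟩ : M) = c • a from Subtype.ext h, map_smul, smul_eq_mul, mul_eq_zero,
    or_iff_right hc]

/-- Inclusion of an intersection of hyperplanes in a hyperplane, tested on points. -/
lemma mem_span_rep_iff {H₁ H₂ H₃ : ℙ K (Module.Dual K M)} :
    H₃.rep ∈ Submodule.span K {H₁.rep, H₂.rep} ↔
      ∀ m : F.Point, m.vec ∈ M → F.Inc M m H₁ → F.Inc M m H₂ → F.Inc M m H₃ := by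
  rw [Projectivization.mem_span_pair_rep_iff]
  constructor
  · intro h m hm
    rw [inc_iff hm, inc_iff hm, inc_iff hm]
    exact h _
  · intro h a
    by_cases ha : a = 0
    · subst ha; simp
    obtain ⟨m, hm, hg⟩ := hM.exists_inc_vec ha
    have := h m hm
    rwa [inc_iff hm, inc_iff hm, inc_iff hm, hg, hg, hg] at this

lemma eq_of_inc {H H' : ℙ K (Module.Dual K M)}
    (h : ∀ m : F.Point, m.vec ∈ M → F.Inc M m H → F.Inc M m H') : H = H' := by
  refine Projectivization.eq_of_rep_eq_zero fun a => ?_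
  by_cases ha : a = 0
  · subst ha; simp
  obtain ⟨m, hm, hg⟩ := hM.exists_inc_vec ha
  have := h m hm
  rwa [inc_iff hm, inc_iff hm, hg, hg] at this

lemma exists_not_inc (H : ℙ K (Module.Dual K M)) : ∃ m : F.Point, m.vec ∈ M ∧ ¬ F.Inc M m H := by
  obtain ⟨v, hv⟩ : ∃ v, H.rep v ≠ 0 := by
    by_contra! h
    exact H.rep_nonzero (LinearMap.ext h)
  obtain ⟨m, hm, hg⟩ := hM.exists_inc_vec (a := v) (by rintro rfl; simp at hv)
  exact ⟨m, hm, fun h => hv ((hg _).1 ((inc_iff hm).1 h))⟩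

lemma perp_of_mem {m m' : F.Point} (hm : m.vec ∈ M) (hm' : m'.vec ∈ M) : m.Perp m' :=
  hM.ts.2 _ hm _ hm'

lemma restrict_ne_zero {x : F.Point} (hx : x.vec ∉ M) : (F.data.f x.vec).domRestrict M ≠ 0 := by
  intro h
  refine hx (hM.mem _ x.vec_S fun a ha => F.data.symm _ _ ?_)
  exact LinearMap.congr_fun h ⟨a, ha⟩

variable [Nonempty (ℙ K (Module.Dual K M))]

lemma hyp_rep_eq_zero {x : F.Point} (hx : x.vec ∉ M) (a : M) :
    (F.hyp M x).rep a = 0 ↔ F.data.f x.vec a = 0 := by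
  rw [hyp, dif_pos (hM.restrict_ne_zero hx)]
  obtain ⟨c, hc⟩ := Projectivization.exists_smul_eq_mk_rep K _ (hM.restrict_ne_zero hx)
  rw [← hc, Units.smul_def, LinearMap.smul_apply, smul_eq_mul, mul_eq_zero,
    or_iff_right c.ne_zero, LinearMap.domRestrict_apply]

lemma inc_hyp_iff {m x : F.Point} (hm : m.vec ∈ M) (hx : x.vec ∉ M) :
    F.Inc M m (F.hyp M x) ↔ m.Perp x := by
  rw [inc_iff hm, hM.hyp_rep_eq_zero hx]
  exact F.data.comm

/-- A singular vector outside `M` orthogonal to the hyperplane `H` of `M` cuts out `H`. -/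
lemma exists_point_hyp {H : ℙ K (Module.Dual K M)} {w : V} (hw : F.data.S w) (hwM : w ∉ M)
    (h : ∀ a : M, H.rep a = 0 → F.data.f a w = 0) :
    ∃ y : F.Point, y.vec ∉ M ∧ F.hyp M y = H ∧ (∃ c : K, c ≠ 0 ∧ y.vec = c • w) := by
  have hw0 : w ≠ 0 := fun h => hwM (h ▸ M.zero_mem)
  obtain ⟨c, hc, hv⟩ := Point.vec_mk' w hw0 hw
  have hyM : (Point.mk' w hw0 hw).vec ∉ M := by
    rwa [hv, M.smul_mem_iff hc]
  refine ⟨_, hyM, ?_, c, hc, hv⟩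
  refine (Projectivization.eq_of_rep_eq_zero fun a ha => ?_).symm
  rw [hM.hyp_rep_eq_zero hyM, hv]
  exact F.data.f_smul_left c (F.data.symm _ _ (h a ha))

lemma exists_hyp_eq [FiniteDimensional K V] (hF : F.data.Nondeg) (H : ℙ K (Module.Dual K M)) :
    ∃ x : F.Point, x.vec ∉ M ∧ F.hyp M x = H := by
  obtain ⟨b, hb⟩ : ∃ b, H.rep b ≠ 0 := by
    by_contra! h
    exact H.rep_nonzero (LinearMap.ext h)
  obtain ⟨s, hs⟩ := IsNoetherian.noetherian ((LinearMap.ker H.rep).map M.subtype)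
  have hsM : ∀ a ∈ s, ∃ h : a ∈ M, H.rep ⟨a, h⟩ = 0 := by
    intro a ha
    have : a ∈ (LinearMap.ker H.rep).map M.subtype := hs ▸ Submodule.subset_span ha
    obtain ⟨a', ha', rfl⟩ := this
    exact ⟨a'.2, ha'⟩
  obtain ⟨w, ⟨hw, hws⟩, hbw⟩ := F.data.exists_perp_not_perp hF s (b : V) (by
      rw [hs]
      rintro ⟨b', hb', h⟩
      exact hb (by rwa [Subtype.ext h] at hb'))
    (fun a ha => hM.ts.1 a (hsM a ha).1) (fun a ha a' ha' => hM.ts.2 a (hsM a ha).1 a' (hsM a' ha').1)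
    (hM.ts.1 b b.2) (fun a ha => hM.ts.2 a (hsM a ha).1 b b.2)
  obtain ⟨y, hy, hyH, _⟩ := hM.exists_point_hyp (H := H) hw
    (fun h => hbw (hM.ts.2 b b.2 w h)) (fun a ha => by
      refine F.data.f_eq_zero_of_mem_span hws ?_
      rw [hs]
      exact ⟨a, ha, rfl⟩)
  exact ⟨y, hy, hyH⟩

/-- Every hyperplane other than `hyp x` is cut out by a point collinear to `x`: a point cutting it
out can be moved along the hyperplane. -/
lemma exists_perp_hyp_eq [FiniteDimensional K V] (hF : F.data.Nondeg) {x : F.Point}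
    (hx : x.vec ∉ M) {H : ℙ K (Module.Dual K M)} (hH : H ≠ F.hyp M x) :
    ∃ y : F.Point, y.vec ∉ M ∧ F.hyp M y = H ∧ x.Perp y := by
  obtain ⟨y₀, hy₀, rfl⟩ := hM.exists_hyp_eq hF H
  obtain ⟨b, hb, hxb⟩ : ∃ b : M, (F.hyp M y₀).rep b = 0 ∧ F.data.f x.vec b ≠ 0 := by
    by_contra! h
    refine hH (Projectivization.eq_of_rep_eq_zero fun a ha => ?_)
    rw [hM.hyp_rep_eq_zero hx]
    exact h a ha
  rw [hM.hyp_rep_eq_zero hy₀] at hb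
  set t := -(F.data.f x.vec y₀.vec / F.data.f x.vec b) with ht
  obtain ⟨y, hy, hyH, c, hc, hv⟩ := hM.exists_point_hyp (H := F.hyp M y₀)
    (w := y₀.vec + t • (b : V)) (F.data.add_smul_mem y₀.vec_S (hM.ts.1 b b.2) hb t)
    (fun h => hy₀ ((M.add_mem_iff_left (M.smul_mem t b.2)).1 h)) (fun a ha => by
      rw [hM.hyp_rep_eq_zero hy₀] at ha
      rw [map_add, map_smul, F.data.symm _ _ ha, hM.ts.2 a a.2 b b.2, smul_zero, add_zero])
  refine ⟨y, hy, hyH, ?_⟩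
  rw [Point.Perp, hv, map_smul, map_add, map_smul, ht, smul_eq_mul, smul_eq_mul]
  field_simp; ring

/-- Collinear points outside `M` that cut out the same hyperplane span a line meeting `M`. -/
lemma exists_mem_of_hyp_eq {x z : F.Point} (hx : x.vec ∉ M) (hz : z.vec ∉ M) (hxz : x.Perp z)
    (h : F.hyp M z = F.hyp M x) : ∃ c : K, z.vec - c • x.vec ∈ M := by
  obtain ⟨a, ha⟩ : ∃ a : M, F.data.f x.vec a ≠ 0 := by
    by_contra! h
    exact hM.restrict_ne_zero hx (LinearMap.ext h)
  have ha' : F.data.f a x.vec ≠ 0 := fun h => ha (F.data.symm _ _ h)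
  set c := F.data.f a z.vec / F.data.f a x.vec with hc
  have hker : ∀ b : M, F.data.f x.vec b = 0 → F.data.f z.vec b = 0 := by
    intro b hb
    rwa [← hM.hyp_rep_eq_zero hx, ← h, hM.hyp_rep_eq_zero hz] at hb
  refine ⟨c, ?_⟩
  have hS : F.data.S (z.vec - c • x.vec) := by
    rw [sub_eq_add_neg, ← neg_smul]
    exact F.data.add_smul_mem z.vec_S x.vec_S hxz.symm _
  refine hM.mem _ hS fun b hb => ?_
  have h1 : F.data.f a (z.vec - c • x.vec) = 0 := by
    rw [map_sub, map_smul, smul_eq_mul, hc]; field_simp; ring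
  set s := F.data.f x.vec b / F.data.f x.vec a with hs
  have h2 : F.data.f x.vec (b - s • (a : V)) = 0 := by
    rw [map_sub, map_smul, smul_eq_mul, hs]; field_simp; ring
  have h3 : F.data.f (b - s • (a : V)) (z.vec - c • x.vec) = 0 := by
    have := hker (⟨b, hb⟩ - s • a) h2
    rw [map_sub, map_smul, F.data.symm _ _ h2, smul_zero, sub_zero]
    exact F.data.symm _ _ this
  have := F.data.f_add_left h3 (F.data.f_smul_left s h1)
  rwa [sub_add_cancel] at this

/-- The line on two collinear points `x`, `y` outside `M` with `hyp x ≠ hyp y` induces the full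
pencil of hyperplanes containing `hyp x ∩ hyp y`. -/
lemma exists_mem_span_hyp_eq {x y : F.Point} (hx : x.vec ∉ M) (hy : y.vec ∉ M) (hxy : x.Perp y)
    (hne : F.hyp M x ≠ F.hyp M y) {H : ℙ K (Module.Dual K M)}
    (hH : H.rep ∈ Submodule.span K {(F.hyp M x).rep, (F.hyp M y).rep}) :
    ∃ z : F.Point, z.vec ∉ M ∧ z.vec ∈ Submodule.span K {x.vec, y.vec} ∧ F.hyp M z = H := by
  by_cases hHx : H = F.hyp M x
  · exact ⟨x, hx, Submodule.subset_span (by simp), hHx.symm⟩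
  obtain ⟨s, t, hst⟩ := Submodule.mem_span_pair.1 hH
  have ht : t ≠ 0 := by
    rintro rfl
    refine hHx (Projectivization.eq_of_rep_eq_zero fun a ha => ?_).symm
    rw [← hst]; simp [ha]
  obtain ⟨a, ha, hxa⟩ : ∃ a : M, H.rep a = 0 ∧ F.data.f x.vec a ≠ 0 := by
    by_contra! h
    refine hHx (Projectivization.eq_of_rep_eq_zero fun a ha => ?_)
    rw [hM.hyp_rep_eq_zero hx]
    exact h a ha
  have hax : F.data.f a x.vec ≠ 0 := fun h => hxa (F.data.symm _ _ h)
  set c := -(F.data.f a y.vec / F.data.f a x.vec) with hc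
  set w := y.vec + c • x.vec with hw
  have haw : F.data.f a w = 0 := by
    rw [hw, map_add, map_smul, smul_eq_mul, hc]; field_simp; ring
  have hker : ∀ b : M, H.rep b = 0 → F.data.f x.vec b = 0 → F.data.f y.vec b = 0 := by
    intro b hb hxb
    rw [← hM.hyp_rep_eq_zero hx] at hxb
    rw [← hM.hyp_rep_eq_zero hy]
    rw [← hst] at hb
    simpa [hxb, ht] using hb
  have hwM : w ∉ M := by
    intro h
    refine hne (Projectivization.eq_of_rep_eq_zero fun b hb => ?_)
    rw [hM.hyp_rep_eq_zero hx] at hb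
    rw [hM.hyp_rep_eq_zero hy]
    have := hM.ts.2 b b.2 w h
    rw [hw, map_add, map_smul, F.data.symm _ _ hb, smul_zero, add_zero] at this
    exact F.data.symm _ _ this
  obtain ⟨z, hz, hzH, c', hc', hzv⟩ := hM.exists_point_hyp (H := H) (w := w)
    (F.data.add_smul_mem y.vec_S x.vec_S hxy.symm c) hwM (fun b hb => by
      set r := F.data.f x.vec b / F.data.f x.vec a with hr
      have h2 : F.data.f x.vec (b - r • a : M) = 0 := by
        rw [Submodule.coe_sub, Submodule.coe_smul, map_sub, map_smul, smul_eq_mul, hr]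
        field_simp; ring
      have h3 := hker (b - r • a) (by rw [map_sub, map_smul, hb, ha, smul_zero, sub_zero]) h2
      have h4 : F.data.f (b - r • a : M) w = 0 := by
        rw [hw, map_add, map_smul, F.data.symm _ _ h3, F.data.symm _ _ h2, smul_zero, add_zero]
      have := F.data.f_add_left h4 (F.data.f_smul_left r haw)
      rwa [Submodule.coe_sub, Submodule.coe_smul, sub_add_cancel] at this)
  refine ⟨z, hz, ?_, hzH⟩
  rw [hzv]
  refine Submodule.smul_mem _ _ (Submodule.add_mem _ (Submodule.subset_span (by simp))
    (Submodule.smul_mem _ _ (Submodule.subset_span (by simp))))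

lemma hyp_mem_span {x y z : F.Point} (hx : x.vec ∉ M) (hy : y.vec ∉ M) (hz : z.vec ∉ M)
    (h : z.vec ∈ Submodule.span K {x.vec, y.vec}) :
    (F.hyp M z).rep ∈ Submodule.span K {(F.hyp M x).rep, (F.hyp M y).rep} := by
  rw [Projectivization.mem_span_pair_rep_iff]
  intro a h1 h2
  rw [hM.hyp_rep_eq_zero hx] at h1
  rw [hM.hyp_rep_eq_zero hy] at h2
  rw [hM.hyp_rep_eq_zero hz]
  refine F.data.f_eq_zero_of_mem_span (A := {x.vec, y.vec}) ?_ h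
  rintro b (rfl | rfl)
  · exact h1
  · exact h2

end IsGenerator

end PolarForm

namespace PolarForm

variable {K V : Type*} [Field K] [AddCommGroup V] [Module K V] {F : PolarForm K V}
variable {M : Submodule K V}

/-! ### The switching system of a generator -/

lemma card_filter_eq_natCard {α : Type*} [Fintype α] (p : α → Prop) {_ : DecidablePred p} :
    (Finset.univ.filter p).card = Nat.card {x // p x} := by
  rw [Nat.card_eq_fintype_card, Fintype.card_subtype]

namespace IsGenerator

variable (hM : F.IsGenerator M) [Finite K] [FiniteDimensional K V]

lemma card_inc {m : F.Point} (hm : m.vec ∈ M) :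
    Nat.card {H // F.Inc M m H} = gnum (Nat.card K) (Module.finrank K M - 1) := by
  have hne : Module.Dual.eval K M ⟨m.vec, hm⟩ ≠ 0 := by
    rw [Ne, Module.eval_apply_eq_zero_iff]
    exact fun h => m.vec_ne (congrArg Subtype.val h)
  have h1 := Module.Dual.finrank_ker_add_one_of_ne_zero hne
  rw [Subspace.dual_finrank_eq] at h1
  rw [← h1, Nat.add_sub_cancel, ← card_projectivization_mem]
  exact Nat.card_congr (Equiv.subtypeEquivRight fun H => inc_iff hm)

lemma card_inc_inc {m m' : F.Point} (hm : m.vec ∈ M) (hm' : m'.vec ∈ M) (hne : m ≠ m') :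
    Nat.card {H // F.Inc M m H ∧ F.Inc M m' H} =
      gnum (Nat.card K) (Module.finrank K M - 2) := by
  have hne0 : Module.Dual.eval K M ⟨m.vec, hm⟩ ≠ 0 := by
    rw [Ne, Module.eval_apply_eq_zero_iff]
    exact fun h => m.vec_ne (congrArg Subtype.val h)
  have h1 := finrank_ker_inf_ker (g' := Module.Dual.eval K M ⟨m'.vec, hm'⟩) hne0 (by
    intro c hc
    rw [← map_smul, ← sub_eq_zero, ← map_sub, Module.eval_apply_eq_zero_iff, sub_eq_zero] at hc
    exact hne (Point.eq_of_vec_eq (c := c) (congrArg Subtype.val hc).symm).symm)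
  rw [Subspace.dual_finrank_eq] at h1
  rw [← h1, Nat.add_sub_cancel, ← card_projectivization_mem]
  exact Nat.card_congr (Equiv.subtypeEquivRight fun H => and_congr (inc_iff hm) (inc_iff hm'))

include hM

lemma card_points_subspace (W : Submodule K M) :
    Nat.card {m : F.Point // ∃ hm : m.vec ∈ M, (⟨m.vec, hm⟩ : M) ∈ W} =
      gnum (Nat.card K) (Module.finrank K W) := by
  have hle : W.map M.subtype ≤ M := Submodule.map_subtype_le M W
  rw [(Submodule.equivMapOfInjective _ (Submodule.injective_subtype _) W).finrank_eq,
    ← F.card_points_le ⟨fun x hx => hM.ts.1 x (hle hx),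
      fun x hx y hy => hM.ts.2 x (hle hx) y (hle hy)⟩]
  refine Nat.card_congr (Equiv.subtypeEquivRight fun m => ⟨?_, ?_⟩)
  · rintro ⟨hm, h⟩; exact ⟨_, h, rfl⟩
  · rintro ⟨a, ha, h⟩
    have hm : m.vec ∈ M := by rw [← h]; exact a.2
    exact ⟨hm, by rwa [show (⟨m.vec, hm⟩ : M) = a from Subtype.ext h.symm]⟩

lemma card_mem_inc (H : ℙ K (Module.Dual K M)) :
    Nat.card {m : F.Point // m.vec ∈ M ∧ F.Inc M m H} =
      gnum (Nat.card K) (Module.finrank K M - 1) := by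
  have h1 := Module.Dual.finrank_ker_add_one_of_ne_zero H.rep_nonzero
  rw [← h1, Nat.add_sub_cancel, ← hM.card_points_subspace]
  refine Nat.card_congr (Equiv.subtypeEquivRight fun m => ⟨?_, ?_⟩)
  · rintro ⟨hm, h⟩; exact ⟨hm, (inc_iff hm).1 h⟩
  · rintro ⟨hm, h⟩; exact ⟨hm, (inc_iff hm).2 h⟩

lemma card_mem_inc_inc {H H' : ℙ K (Module.Dual K M)} (hne : H ≠ H') :
    Nat.card {m : F.Point // m.vec ∈ M ∧ F.Inc M m H ∧ F.Inc M m H'} =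
      gnum (Nat.card K) (Module.finrank K M - 2) := by
  have h1 := finrank_ker_inf_ker (g' := H'.rep) H.rep_nonzero (by
    intro c hc
    refine hne ?_
    rw [← H.mk_rep, ← H'.mk_rep, eq_comm, Projectivization.mk_eq_mk_iff']
    exact ⟨c, hc⟩)
  rw [← h1, Nat.add_sub_cancel, ← hM.card_points_subspace]
  refine Nat.card_congr (Equiv.subtypeEquivRight fun m => ⟨?_, ?_⟩)
  · rintro ⟨hm, h, h'⟩; exact ⟨hm, (inc_iff hm).1 h, (inc_iff hm).1 h'⟩
  · rintro ⟨hm, h, h'⟩; exact ⟨hm, (inc_iff hm).2 h, (inc_iff hm).2 h'⟩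

/-- A generator of the polar space, with the projective space of its hyperplanes. -/
noncomputable def switchSystem [Fintype F.Point] [Fintype (ℙ K (Module.Dual K M))]
    [Nonempty (ℙ K (Module.Dual K M))] (hd : 2 ≤ Module.finrank K M) :
    SwitchSystem F.Point (ℙ K (Module.Dual K M)) where
  G := F.collinearityGraph
  M := {x | x.vec ∈ M}
  hyp := F.hyp M
  I := F.Inc M
  h := gnum (Nat.card K) (Module.finrank K M - 1)
  h₂ := gnum (Nat.card K) (Module.finrank K M - 2)
  clique := fun _ hx _ hy hne => F.adj_iff.2 ⟨hne, hM.perp_of_mem hx hy⟩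
  adj_iff := fun m hm x hx => by
    rw [hM.inc_hyp_iff hm hx, F.adj_iff, and_iff_right]
    rintro rfl
    exact hx hm
  card_blocks := fun _ hm => (card_filter_eq_natCard _).trans (card_inc hm)
  card_points := fun H => (card_filter_eq_natCard _).trans (hM.card_mem_inc H)
  card_blocks_two := fun _ hm _ hm' hne =>
    (card_filter_eq_natCard _).trans (card_inc_inc hm hm' hne)
  card_points_two := fun _ _ hne => (card_filter_eq_natCard _).trans (hM.card_mem_inc_inc hne)
  h₂_lt := gnum_lt_gnum Nat.card_pos (by omega)
  h_lt := (gnum_lt_gnum Nat.card_pos (by omega)).trans_eq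
    ((card_filter_eq_natCard _).trans (F.card_points_le hM.ts)).symm

end IsGenerator

end PolarForm

/-! ### Lines of a graph -/

/-- Adjacency or equality of vertices. -/
def SimpleGraph.EqOrAdj {P : Type*} (G : SimpleGraph P) (x y : P) : Prop := x = y ∨ G.Adj x y

/-- The line on two vertices `x`, `y` of a graph: the vertices equal or adjacent to each common
neighbour of `x` and `y`, where a vertex counts as its own neighbour. In the collinearity graph
of a polar space these are the lines of the polar space. -/
def SimpleGraph.line {P : Type*} (G : SimpleGraph P) (x y : P) : Set P :=
  {z | ∀ w, G.EqOrAdj w x → G.EqOrAdj w y → G.EqOrAdj w z}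

lemma SimpleGraph.EqOrAdj.symm {P : Type*} {G : SimpleGraph P} {x y : P} (h : G.EqOrAdj x y) :
    G.EqOrAdj y x := h.imp Eq.symm SimpleGraph.Adj.symm

lemma SimpleGraph.Iso.eqOrAdj_iff {P Q : Type*} {G : SimpleGraph P} {G' : SimpleGraph Q}
    (g : G ≃g G') {x y : P} : G'.EqOrAdj (g x) (g y) ↔ G.EqOrAdj x y :=
  or_congr g.injective.eq_iff g.map_adj_iff

lemma SimpleGraph.Iso.image_line {P Q : Type*} {G : SimpleGraph P} {G' : SimpleGraph Q}
    (g : G ≃g G') (x y : P) : g '' G.line x y = G'.line (g x) (g y) := by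
  ext z
  obtain ⟨z, rfl⟩ := g.surjective z
  rw [g.injective.mem_set_image]
  constructor
  · intro h w
    obtain ⟨w, rfl⟩ := g.surjective w
    rw [g.eqOrAdj_iff, g.eqOrAdj_iff, g.eqOrAdj_iff]
    exact h w
  · intro h w
    have := h (g w)
    rwa [g.eqOrAdj_iff, g.eqOrAdj_iff, g.eqOrAdj_iff] at this

lemma SimpleGraph.Iso.ncard_line {P Q : Type*} {G : SimpleGraph P} {G' : SimpleGraph Q}
    (g : G ≃g G') (x y : P) : (G'.line (g x) (g y)).ncard = (G.line x y).ncard := by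
  rw [← g.image_line, Set.ncard_image_of_injective _ g.injective]

namespace PolarForm

variable {K V : Type*} [Field K] [AddCommGroup V] [Module K V] {F : PolarForm K V}
variable {M : Submodule K V}

/-- A permutation `τ` of the hyperplanes of `M` *scatters* the point `m` if the hyperplanes that it
maps to the hyperplanes through `m` are not those through some point. -/
def Scatters (F : PolarForm K V) (M : Submodule K V) (τ : Equiv.Perm (ℙ K (Module.Dual K M)))
    (m : F.Point) : Prop :=
  ∀ m' : F.Point, m'.vec ∈ M → ¬ ∀ H, F.Inc M m' H ↔ F.Inc M m (τ H)

/-! ### Lines of the twisted graphs -/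

section points
variable [Finite K] [FiniteDimensional K V]

/-- Polar lines have `|K| + 1` points. -/
lemma ncard_span_pair {x y : F.Point} (hne : x ≠ y) (h : x.Perp y) :
    {z : F.Point | z.vec ∈ Submodule.span K {x.vec, y.vec}}.ncard = Nat.card K + 1 := by
  have hTS : F.data.TS (Submodule.span K {x.vec, y.vec}) := by
    refine F.data.TS_span ?_ ?_
    · rintro a (rfl | rfl)
      exacts [x.vec_S, y.vec_S]
    · rintro a (rfl | rfl) b (rfl | rfl)
      exacts [x.perp_self, h, h.symm, y.perp_self]
  have h2 := finrank_span_eq_card (Point.linearIndependent hne)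
  rw [Matrix.range_cons, Matrix.range_cons, Matrix.range_empty, Set.union_empty,
    Set.singleton_union] at h2
  have := F.card_points_le hTS
  rw [h2] at this
  rw [← Nat.card_coe_set_eq]
  refine this.trans ?_
  simp [gnum, Finset.sum_range_succ, add_comm]

lemma ncard_inc_perm {m : F.Point} (hm : m.vec ∈ M) (τ : Equiv.Perm (ℙ K (Module.Dual K M))) :
    {H | F.Inc M m (τ H)}.ncard = gnum (Nat.card K) (Module.finrank K M - 1) := by
  rw [← IsGenerator.card_inc hm, ← Nat.card_coe_set_eq]
  exact Nat.card_congr (τ.subtypeEquiv fun H => Iff.rfl)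

/-- Since all points lie on equally many hyperplanes, an inclusion suffices to recognize a point
that is not scattered. -/
lemma exists_inc_not_of_scatters {m m' : F.Point} (hm : m.vec ∈ M) (hm' : m'.vec ∈ M)
    (h : F.Scatters M τ m) :
    (∃ H, F.Inc M m' H ∧ ¬ F.Inc M m (τ H)) ∧ ∃ H, F.Inc M m (τ H) ∧ ¬ F.Inc M m' H := by
  have : Finite (Module.Dual K M) := Module.finite_of_finite K
  have hcard : {H | F.Inc M m' H}.ncard = {H | F.Inc M m (τ H)}.ncard := by
    rw [ncard_inc_perm hm τ]
    exact ncard_inc_perm hm' 1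
  have hne : {H | F.Inc M m' H} ≠ {H | F.Inc M m (τ H)} := by
    intro e
    exact h m' hm' fun H => by rw [Set.ext_iff] at e; exact e H
  constructor
  · by_contra! hsub
    exact hne (Set.eq_of_subset_of_ncard_le (fun H hH => hsub H hH) hcard.ge (Set.toFinite _))
  · by_contra! hsub
    exact hne (Set.eq_of_subset_of_ncard_le (fun H hH => hsub H hH) hcard.le
      (Set.toFinite _)).symm

end points

namespace IsGenerator

/-- If two collinear points `x`, `z` outside `M` cut out the same hyperplane, then their line meets
`M` in a point `m`, and a point outside `M` collinear to `x` is collinear to `z` if and only if the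
hyperplane that it cuts out contains `m`. -/
lemma exists_point_on_line (hM : F.IsGenerator M) [Nonempty (ℙ K (Module.Dual K M))] {x z : F.Point} (hx : x.vec ∉ M) (hz : z.vec ∉ M) (hxz : x.Perp z)
    (hne : z ≠ x) (h : F.hyp M z = F.hyp M x) :
    ∃ m : F.Point, m.vec ∈ M ∧ m.vec ∈ Submodule.span K {x.vec, z.vec} ∧
      ∀ w : F.Point, w.vec ∉ M → x.Perp w → (z.Perp w ↔ F.Inc M m (F.hyp M w)) := by
  obtain ⟨c, hc⟩ := hM.exists_mem_of_hyp_eq hx hz hxz h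
  have h0 : z.vec - c • x.vec ≠ 0 := fun h => hne (Point.eq_of_vec_eq (sub_eq_zero.1 h))
  obtain ⟨c', hc', hv⟩ := Point.vec_mk' (F := F) _ h0 (hM.ts.1 _ hc)
  set m := Point.mk' (F := F) _ h0 (hM.ts.1 _ hc) with hm
  have hmM : m.vec ∈ M := by rw [hv]; exact M.smul_mem _ hc
  refine ⟨m, hmM, ?_, fun w hw hxw => ?_⟩
  · rw [hv]
    exact Submodule.smul_mem _ _ (Submodule.sub_mem _ (Submodule.subset_span (by simp))
      (Submodule.smul_mem _ _ (Submodule.subset_span (by simp))))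
  · rw [hM.inc_hyp_iff hmM hw]
    have e : m.Perp w ↔ F.data.f w.vec (z.vec - c • x.vec) = 0 := by
      rw [Point.Perp, F.data.comm, hv, map_smul, smul_eq_mul, mul_eq_zero, or_iff_right hc']
    rw [e, map_sub, map_smul, hxw.symm, smul_zero, sub_zero]
    exact F.data.comm


variable (hM : F.IsGenerator M) [Finite K] [FiniteDimensional K V] [Fintype F.Point]
  [Fintype (ℙ K (Module.Dual K M))] [Nonempty (ℙ K (Module.Dual K M))]
  (hd : 2 ≤ Module.finrank K M) {τ : Equiv.Perm (ℙ K (Module.Dual K M))}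

/-- The graph obtained from the collinearity graph by joining each point `x` outside the generator
`M` to the points of the hyperplane `τ (x^⊥ ∩ M)`. -/
noncomputable def twist (τ : Equiv.Perm (ℙ K (Module.Dual K M))) : SimpleGraph F.Point :=
  (hM.switchSystem hd).twist τ

lemma twist_one : hM.twist hd 1 = F.collinearityGraph := SwitchSystem.twist_one _

lemma adj_in {m m' : F.Point} (hm : m.vec ∈ M) (hm' : m'.vec ∈ M) :
    (hM.twist hd τ).Adj m m' ↔ m ≠ m' :=
  SwitchSystem.twist_adj_in (s := hM.switchSystem hd) hm hm'

lemma eqOrAdj_in {m m' : F.Point} (hm : m.vec ∈ M) (hm' : m'.vec ∈ M) :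
    (hM.twist hd τ).EqOrAdj m m' := by
  rw [SimpleGraph.EqOrAdj, hM.adj_in hd hm hm']
  exact em _

lemma eqOrAdj_out {x y : F.Point} (hx : x.vec ∉ M) (hy : y.vec ∉ M) :
    (hM.twist hd τ).EqOrAdj x y ↔ x.Perp y := by
  rw [SimpleGraph.EqOrAdj, twist,
    SwitchSystem.twist_adj_out (s := hM.switchSystem hd) hx hy]
  change _ ∨ F.collinearityGraph.Adj x y ↔ _
  rw [F.adj_iff]
  refine ⟨?_, fun h => (em (x = y)).imp id fun h' => ⟨h', h⟩⟩
  rintro (rfl | h)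
  · exact x.perp_self
  · exact h.2

lemma adj_mixed {m x : F.Point} (hm : m.vec ∈ M) (hx : x.vec ∉ M) :
    (hM.twist hd τ).Adj m x ↔ F.Inc M m (τ (F.hyp M x)) :=
  SwitchSystem.twist_adj_mixed (s := hM.switchSystem hd) hm hx

lemma eqOrAdj_mixed {m x : F.Point} (hm : m.vec ∈ M) (hx : x.vec ∉ M) :
    (hM.twist hd τ).EqOrAdj m x ↔ F.Inc M m (τ (F.hyp M x)) := by
  rw [SimpleGraph.EqOrAdj, hM.adj_mixed hd hm hx, or_iff_right]
  rintro rfl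
  exact hx hm

/-- Edges inside `M` lie on full lines in every twisted graph. -/
lemma le_ncard_line_in {m m' : F.Point} (hm : m.vec ∈ M) (hm' : m'.vec ∈ M) (hne : m ≠ m') :
    Nat.card K + 1 ≤ ((hM.twist hd τ).line m m').ncard := by
  rw [← ncard_span_pair hne (hM.perp_of_mem hm hm')]
  refine Set.ncard_le_ncard (fun z hz w h1 h2 => ?_) (Set.toFinite _)
  have hz' : z.vec ∈ M := by
    refine (Submodule.span_le.2 ?_) hz
    rintro a (rfl | rfl) <;> assumption
  by_cases hw : w.vec ∈ M
  · exact hM.eqOrAdj_in hd hw hz'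
  · have h1 := (hM.eqOrAdj_mixed hd hm hw).1 h1.symm
    have h2 := (hM.eqOrAdj_mixed hd hm' hw).1 h2.symm
    refine ((hM.eqOrAdj_mixed hd hz' hw).2 ?_).symm
    obtain ⟨s, t, hst⟩ := Submodule.mem_span_pair.1 hz
    rw [inc_iff hm] at h1
    rw [inc_iff hm'] at h2
    rw [inc_iff hz', show (⟨z.vec, hz'⟩ : M) = s • ⟨m.vec, hm⟩ + t • ⟨m'.vec, hm'⟩ from
      Subtype.ext hst.symm, map_add, map_smul, map_smul, h1, h2, smul_zero, smul_zero, add_zero]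

/-- An edge from a scattered point of `M` to a vertex outside `M` lies on a line of size two. -/
lemma ncard_line_le_two (hF : F.data.Nondeg) {m x : F.Point} (hm : m.vec ∈ M) (hx : x.vec ∉ M)
    (hadj : (hM.twist hd τ).Adj m x) (h : F.Scatters M τ m) :
    ((hM.twist hd τ).line m x).ncard ≤ 2 := by
  have hmx := (hM.adj_mixed hd hm hx).1 hadj
  refine (Set.ncard_le_ncard (t := {m, x}) ?_ (Set.toFinite _)).trans ((Set.ncard_insert_le _ _).trans (by simp))
  intro z hz
  by_cases hzM : z.vec ∈ M
  · left
    by_contra hne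
    obtain ⟨H, hH, hHz⟩ := exists_inc_not_inc hm hzM (Ne.symm hne)
    obtain ⟨H, rfl⟩ := τ.surjective H
    obtain ⟨y, hy, hyH, hxy⟩ : ∃ y : F.Point, y.vec ∉ M ∧ F.hyp M y = H ∧ x.Perp y := by
      by_cases hHx : H = F.hyp M x
      · exact ⟨x, hx, hHx.symm, x.perp_self⟩
      · exact hM.exists_perp_hyp_eq hF hx hHx
    have := hz y ((hM.eqOrAdj_mixed hd hm hy).2 (hyH ▸ hH)).symm
      ((hM.eqOrAdj_out hd hy hx).2 hxy.symm)
    exact hHz (hyH ▸ (hM.eqOrAdj_mixed hd hzM hy).1 this.symm)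
  · right
    by_contra hne
    have hxz : x.Perp z := (hM.eqOrAdj_out hd hx hzM).1 (hz x (Or.inr hadj.symm) (Or.inl rfl))
    have hhyp : F.hyp M z = F.hyp M x := by
      refine τ.injective (hM.eq_of_inc fun m' hm' h' => ?_).symm
      exact (hM.eqOrAdj_mixed hd hm' hzM).1
        (hz m' (hM.eqOrAdj_in hd hm' hm) ((hM.eqOrAdj_mixed hd hm' hx).2 h'))
    obtain ⟨p, hp, -, hpw⟩ := hM.exists_point_on_line hx hzM hxz hne hhyp
    obtain ⟨H, hH, hHp⟩ := (exists_inc_not_of_scatters hm hp h).2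
    obtain ⟨y, hy, hyH, hxy⟩ : ∃ y : F.Point, y.vec ∉ M ∧ F.hyp M y = H ∧ x.Perp y := by
      by_cases hHx : H = F.hyp M x
      · exact ⟨x, hx, hHx.symm, x.perp_self⟩
      · exact hM.exists_perp_hyp_eq hF hx hHx
    have := hz y ((hM.eqOrAdj_mixed hd hm hy).2 (hyH ▸ hH)).symm
      ((hM.eqOrAdj_out hd hy hx).2 hxy.symm)
    exact hHp (hyH ▸ (hpw y hy hxy).1 ((hM.eqOrAdj_out hd hy hzM).1 this).symm)

lemma mem_span_of_mem_line (hF : F.data.Nondeg) {x y z : F.Point} (hx : x.vec ∉ M)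
    (hy : y.vec ∉ M) (hxy : x.Perp y) (hzM : z.vec ∉ M) (hz : z ∈ (hM.twist hd τ).line x y) :
    z.vec ∈ Submodule.span K {x.vec, y.vec} :=
  mem_span_of_forall_perp hF hx hy hxy fun w hw h1 h2 =>
    (hM.eqOrAdj_out hd hw hzM).1 (hz w ((hM.eqOrAdj_out hd hw hx).2 h1)
      ((hM.eqOrAdj_out hd hw hy).2 h2))

/-- If `τ` scatters all points of `M`, then two adjacent vertices outside `M` attached to the same
hyperplane of `M` are not on a full line: the point of `M` on their polar line is lost. -/
lemma ncard_line_lt (hF : F.data.Nondeg) (hτ : ∀ m : F.Point, m.vec ∈ M → F.Scatters M τ m)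
    {x y : F.Point} (hx : x.vec ∉ M) (hy : y.vec ∉ M) (hne : y ≠ x) (hxy : x.Perp y)
    (hhyp : F.hyp M y = F.hyp M x) :
    ((hM.twist hd τ).line x y).ncard < Nat.card K + 1 := by
  obtain ⟨p, hp, hpl, hpw⟩ := hM.exists_point_on_line hx hy hxy hne hhyp
  rw [← ncard_span_pair hne.symm hxy]
  refine Set.ncard_lt_ncard ?_ (Set.toFinite _)
  have hout : ∀ z ∈ (hM.twist hd τ).line x y, z.vec ∉ M := by
    intro z hz hzM
    obtain ⟨H, hH, hHz⟩ := (exists_inc_not_of_scatters hzM hp (hτ z hzM)).1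
    obtain ⟨w, hw, hwH, hxw⟩ : ∃ y : F.Point, y.vec ∉ M ∧ F.hyp M y = H ∧ x.Perp y := by
      by_cases hHx : H = F.hyp M x
      · exact ⟨x, hx, hHx.symm, x.perp_self⟩
      · exact hM.exists_perp_hyp_eq hF hx hHx
    have := hz w ((hM.eqOrAdj_out hd hw hx).2 hxw.symm)
      ((hM.eqOrAdj_out hd hw hy).2 ((hpw w hw hxw).2 (hwH ▸ hH)).symm)
    exact hHz (hwH ▸ (hM.eqOrAdj_mixed hd hzM hw).1 this.symm)
  refine ⟨fun z hz => hM.mem_span_of_mem_line hd hF hx hy hxy (hout z hz) hz, fun h => ?_⟩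
  exact hout p (h hpl) hp

end IsGenerator

end PolarForm

/-! ### Collineations of a projective space -/

namespace Projectivization

variable {K E : Type*} [Field K] [AddCommGroup E] [Module K E]

/-- Permutations of the points of a projective space that map lines into lines. -/
def IsCollineation (σ : Equiv.Perm (ℙ K E)) : Prop :=
  ∀ a b c : ℙ K E, c.rep ∈ Submodule.span K {a.rep, b.rep} →
    (σ c).rep ∈ Submodule.span K {(σ a).rep, (σ b).rep}

lemma mk_rep_mem_iff {v : E} (hv : v ≠ 0) (W : Submodule K E) : (mk K v hv).rep ∈ W ↔ v ∈ W := by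
  obtain ⟨c, hc⟩ := exists_smul_eq_mk_rep K v hv
  rw [← hc, Units.smul_def, W.smul_mem_iff c.ne_zero]

lemma eq_mk_of_rep_eq {H : ℙ K E} {v : E} (hv : v ≠ 0) {c : K} (h : H.rep = c • v) :
    H = mk K v hv := by
  rw [← H.mk_rep, mk_eq_mk_iff']
  exact ⟨c, h.symm⟩

/-- The subspace whose points are those mapped into `W` by a collineation. -/
def IsCollineation.comap {σ : Equiv.Perm (ℙ K E)} (hσ : IsCollineation σ) (W : Submodule K E) :
    Submodule K E where
  carrier := {v | ∀ hv : v ≠ 0, (σ (mk K v hv)).rep ∈ W}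
  zero_mem' := fun h => absurd rfl h
  add_mem' := by
    intro v w hv hw hvw
    by_cases hv0 : v = 0
    · subst hv0
      simp only [zero_add] at hvw ⊢
      exact hw hvw
    by_cases hw0 : w = 0
    · subst hw0
      simp only [add_zero] at hvw ⊢
      exact hv hvw
    refine (Submodule.span_le.2 ?_) (hσ (mk K v hv0) (mk K w hw0) (mk K (v + w) hvw) ?_)
    · rintro x (rfl | rfl)
      exacts [hv hv0, hw hw0]
    · rw [mk_rep_mem_iff]
      refine Submodule.add_mem _ ?_ ?_
      · rw [← mk_rep_mem_iff hv0]; exact Submodule.subset_span (by simp)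
      · rw [← mk_rep_mem_iff hw0]; exact Submodule.subset_span (by simp)
  smul_mem' := by
    intro c v hv hcv
    have hv0 : v ≠ 0 := by rintro rfl; simp at hcv
    have : mk K (c • v) hcv = mk K v hv0 := by
      rw [mk_eq_mk_iff']; exact ⟨c, rfl⟩
    rw [this]
    exact hv hv0

lemma IsCollineation.mem_comap {σ : Equiv.Perm (ℙ K E)} (hσ : IsCollineation σ)
    {W : Submodule K E} {v : E} (hv : v ≠ 0) : v ∈ hσ.comap W ↔ (σ (mk K v hv)).rep ∈ W :=
  ⟨fun h => h hv, fun h _ => h⟩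

lemma IsCollineation.rep_mem_comap {σ : Equiv.Perm (ℙ K E)} (hσ : IsCollineation σ)
    {W : Submodule K E} {H : ℙ K E} : H.rep ∈ hσ.comap W ↔ (σ H).rep ∈ W := by
  rw [hσ.mem_comap H.rep_nonzero, H.mk_rep]

lemma IsCollineation.mul {σ σ' : Equiv.Perm (ℙ K E)} (hσ : IsCollineation σ)
    (hσ' : IsCollineation σ') : IsCollineation (σ * σ') :=
  fun a b c h => hσ _ _ _ (hσ' a b c h)

lemma isCollineation_one : IsCollineation (1 : Equiv.Perm (ℙ K E)) := fun _ _ _ h => h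

/-- The group of collineations. -/
def collineations (K E : Type*) [Field K] [AddCommGroup E] [Module K E] [Finite (ℙ K E)] :
    Subgroup (Equiv.Perm (ℙ K E)) where
  carrier := {σ | IsCollineation σ}
  one_mem' := isCollineation_one
  mul_mem' := IsCollineation.mul
  inv_mem' := by
    -- A permutation of a finite set has its inverse among its powers.
    intro σ hσ
    have hpow : ∀ n : ℕ, IsCollineation (σ ^ n) := by
      intro n
      induction n with
      | zero => exact isCollineation_one
      | succ n ih => rw [pow_succ]; exact ih.mul hσ
    have h : σ⁻¹ = σ ^ (orderOf σ - 1) := by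
      rw [inv_eq_iff_mul_eq_one, ← pow_succ', Nat.sub_add_cancel (orderOf_pos σ),
        pow_orderOf_eq_one]
    change IsCollineation σ⁻¹
    rw [h]
    exact hpow _

section basis

variable {n : ℕ} (b : Module.Basis (Fin (n + 1)) K E)

lemma basis_add_smul_ne_zero (j : Fin n) (t : K) : b 0 + t • b j.succ ≠ 0 := by
  intro h
  have := congrArg (fun v => b.repr v 0) h
  simp at this

/-- The point `⟨e₀ + t eⱼ⟩` on the line joining two base points. -/
noncomputable def axisPoint (j : Fin n) (t : K) : ℙ K E :=
  mk K (b 0 + t • b j.succ) (basis_add_smul_ne_zero b j t)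

lemma axisPoint_injective (j : Fin n) : Function.Injective (axisPoint b j) := by
  intro t t' h
  rw [axisPoint, axisPoint, mk_eq_mk_iff'] at h
  obtain ⟨c, hc⟩ := h
  have h0 := congrArg (fun v => b.repr v 0) hc
  have h1 := congrArg (fun v => b.repr v j.succ) hc
  simp at h0 h1
  rw [h0, one_mul] at h1
  exact h1.symm

/-- A collineation that fixes the base points and all points on the lines joining the base point
`⟨e₀⟩` to the others is the identity. -/
lemma IsCollineation.eq_one {σ : Equiv.Perm (ℙ K E)} (hσ : IsCollineation σ)
    (h1 : ∀ i, σ (mk K (b i) (b.ne_zero i)) = mk K (b i) (b.ne_zero i))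
    (h2 : ∀ j t, t ≠ 0 → σ (axisPoint b j t) = axisPoint b j t) : σ = 1 := by
  have h2' : ∀ j t, σ (axisPoint b j t) = axisPoint b j t := by
    intro j t
    by_cases ht : t = 0
    · subst ht
      have : axisPoint b j 0 = mk K (b 0) (b.ne_zero 0) := by
        rw [axisPoint, mk_eq_mk_iff']; exact ⟨1, by simp⟩
      rw [this, h1]
    · exact h2 j t ht
  -- A point with nonzero zeroth coordinate is the intersection of hyperplanes spanned by
  -- fixed points.
  have h3 : ∀ H : ℙ K E, b.repr H.rep 0 ≠ 0 → σ H = H := by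
    intro H hH
    set x := b.repr H.rep with hx
    have hmem : ∀ j : Fin n,
        x j.succ * b.repr (σ H).rep 0 = x 0 * b.repr (σ H).rep j.succ := by
      intro j
      set W : Submodule K E := LinearMap.ker (x j.succ • b.coord 0 - x 0 • b.coord j.succ) with hW
      have hWmem : ∀ v, v ∈ W ↔ x j.succ * b.repr v 0 = x 0 * b.repr v j.succ := by
        intro v; rw [hW, LinearMap.mem_ker, LinearMap.sub_apply, sub_eq_zero]; rfl
      rw [← hWmem, ← hσ.rep_mem_comap, ← b.sum_repr H.rep,
        ← Finset.add_sum_erase _ _ (Finset.mem_univ 0),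
        ← Finset.add_sum_erase _ _ (a := j.succ) (by simp), ← add_assoc]
      refine Submodule.add_mem _ ?_ (Submodule.sum_mem _ fun i hi => ?_)
      · have e : x 0 • b 0 + x j.succ • b j.succ =
            x 0 • (b 0 + (x j.succ / x 0) • b j.succ) := by
          rw [smul_add, smul_smul, mul_div_cancel₀ _ hH]
        rw [← hx, e]
        refine Submodule.smul_mem _ _ ?_
        rw [hσ.mem_comap (basis_add_smul_ne_zero b j _)]
        change (σ (axisPoint b j _)).rep ∈ W
        rw [h2', axisPoint, mk_rep_mem_iff, hWmem]
        simp [mul_div_cancel₀ _ hH]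
      · refine Submodule.smul_mem _ _ ?_
        rw [hσ.mem_comap (b.ne_zero i), h1, mk_rep_mem_iff, hWmem]
        simp only [Finset.mem_erase, Finset.mem_univ, and_true] at hi
        simp [hi.1, hi.2]
    have hrep : (σ H).rep = (b.repr (σ H).rep 0 / x 0) • H.rep := by
      apply b.repr.injective
      ext i
      rw [map_smul, Finsupp.smul_apply, smul_eq_mul, ← hx]
      refine Fin.cases ?_ (fun j => ?_) i
      · rw [div_mul_cancel₀ _ hH]
      · rw [div_mul_eq_mul_div, mul_comm, hmem j, mul_div_cancel_left₀ _ hH]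
    rw [eq_mk_of_rep_eq H.rep_nonzero hrep, H.mk_rep]
  ext1 H
  rw [Equiv.Perm.one_apply]
  by_cases hH : b.repr H.rep 0 = 0
  swap
  · exact h3 H hH
  have hu : b 0 + H.rep ≠ 0 := by
    intro h
    have := congrArg (fun v => b.repr v 0) h
    simp [hH] at this
  have hfix : σ (mk K _ hu) = mk K _ hu := by
    apply h3
    have : (mk K _ hu).rep ∉ LinearMap.ker (b.coord 0) := by
      rw [mk_rep_mem_iff]; simp [hH]
    simpa using this
  have hline := hσ (mk K _ (b.ne_zero 0)) (mk K _ hu) H (by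
    refine (Submodule.add_mem_iff_right _ (x := b 0) ?_).1 ?_
    rotate_left
    · rw [← mk_rep_mem_iff hu]; exact Submodule.subset_span (by simp)
    · rw [← mk_rep_mem_iff (b.ne_zero 0)]; exact Submodule.subset_span (by simp))
  rw [h1, hfix] at hline
  have hline' : (σ H).rep ∈ Submodule.span K {b 0, H.rep} := by
    refine (Submodule.span_le.2 ?_) hline
    rintro x (rfl | rfl)
    · rw [SetLike.mem_coe, mk_rep_mem_iff]; exact Submodule.subset_span (by simp)
    · rw [SetLike.mem_coe, mk_rep_mem_iff]
      exact Submodule.add_mem _ (Submodule.subset_span (by simp)) (Submodule.subset_span (by simp))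
  obtain ⟨s, t, hst⟩ := Submodule.mem_span_pair.1 hline'
  by_cases hs : s = 0
  · subst hs
    rw [zero_smul, zero_add] at hst
    rw [eq_mk_of_rep_eq H.rep_nonzero hst.symm, H.mk_rep]
  · refine σ.injective (h3 (σ H) ?_)
    rw [← hst]
    simpa [hH] using hs

variable [Finite K]

include b in
/-- The order of the group of collineations, bounded by the number of images of the base points
times the number of ways in which the lines on one base point are permuted. -/
lemma card_collineations_le [Finite (ℙ K E)] : Nat.card (collineations K E) ≤
    Nat.card (ℙ K E) ^ (n + 1) * ((Nat.card K - 1)!) ^ n := by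
  classical
  have : Fintype K := Fintype.ofFinite K
  have : Fintype (ℙ K E) := Fintype.ofFinite _
  set e : Fin (n + 1) → ℙ K E := fun i => mk K (b i) (b.ne_zero i) with he
  set S := MulAction.stabilizer (collineations K E) e with hS
  have hSmem : ∀ s : S, IsCollineation (s.1.1) ∧ ∀ i, s.1.1 (e i) = e i :=
    fun s => ⟨s.1.2, fun i => congrFun s.2 i⟩
  have horb : Nat.card (collineations K E) =
      (MulAction.orbit (collineations K E) e).ncard * Nat.card S := by
    rw [hS, ← MulAction.index_stabilizer, Subgroup.index_mul_card]
  have h1 : (MulAction.orbit (collineations K E) e).ncard ≤ Nat.card (ℙ K E) ^ (n + 1) := by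
    refine (Set.ncard_le_card _).trans ?_
    rw [Nat.card_fun]; simp
  have hθ : ∀ s : S, ∀ j : Fin n, ∀ t : Kˣ, ∃ u : Kˣ,
      s.1.1 (axisPoint b j t) = axisPoint b j u := by
    intro s j t
    obtain ⟨hσ, hfix⟩ := hSmem s
    set σ := s.1.1
    have hl := hσ (e 0) (e j.succ) (axisPoint b j t) (by
      rw [axisPoint, mk_rep_mem_iff]
      refine Submodule.add_mem _ ?_ (Submodule.smul_mem _ _ ?_)
      · rw [← mk_rep_mem_iff (b.ne_zero 0)]; exact Submodule.subset_span (by simp [he])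
      · rw [← mk_rep_mem_iff (b.ne_zero j.succ)]; exact Submodule.subset_span (by simp [he]))
    rw [hfix, hfix] at hl
    have hl' : (σ (axisPoint b j t)).rep ∈ Submodule.span K {b 0, b j.succ} := by
      refine (Submodule.span_le.2 ?_) hl
      rintro x (rfl | rfl)
      · rw [SetLike.mem_coe, mk_rep_mem_iff]; exact Submodule.subset_span (by simp)
      · rw [SetLike.mem_coe, mk_rep_mem_iff]; exact Submodule.subset_span (by simp)
    obtain ⟨α, β, hab⟩ := Submodule.mem_span_pair.1 hl'
    have hα : α ≠ 0 := by
      rintro rfl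
      rw [zero_smul, zero_add] at hab
      have h := eq_mk_of_rep_eq (b.ne_zero j.succ) hab.symm
      have h' := σ.injective (h.trans (hfix j.succ).symm)
      rw [axisPoint, he, mk_eq_mk_iff'] at h'
      obtain ⟨c, hc⟩ := h'
      have := congrArg (fun v => b.repr v 0) hc
      simp at this
    have hβ : β ≠ 0 := by
      rintro rfl
      rw [zero_smul, add_zero] at hab
      have h := eq_mk_of_rep_eq (b.ne_zero 0) hab.symm
      have h' := σ.injective (h.trans (hfix 0).symm)
      rw [axisPoint, he, mk_eq_mk_iff'] at h'
      obtain ⟨c, hc⟩ := h'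
      have := congrArg (fun v => b.repr v j.succ) hc
      simp at this
      exact t.ne_zero this.symm
    refine ⟨Units.mk0 (β / α) (div_ne_zero hβ hα), ?_⟩
    refine eq_mk_of_rep_eq (c := α) _ ?_
    rw [← hab, smul_add, smul_smul, Units.val_mk0, mul_div_cancel₀ _ hα]
  choose θ hθ using hθ
  have hinj : ∀ s j, Function.Injective (θ s j) := by
    intro s j t t' h
    have h' := (hθ s j t).trans ((congrArg (fun u : Kˣ => axisPoint b j u) h).trans
      (hθ s j t').symm)
    exact Units.ext (axisPoint_injective b j (s.1.1.injective h'))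
  have h2 : Nat.card S ≤ ((Nat.card K - 1)!) ^ n := by
    have : Function.Injective (fun s : S => fun j : Fin n =>
        (⟨θ s j, hinj s j⟩ : Kˣ ↪ Kˣ)) := by
      intro s s' h
      have hθeq : ∀ j t, θ s j t = θ s' j t := by
        intro j t
        exact congrArg (fun f : Fin n → (Kˣ ↪ Kˣ) => f j t) h
      have hone : (s'⁻¹ * s).1.1 = 1 := by
        refine IsCollineation.eq_one b (hSmem (s'⁻¹ * s)).1 (hSmem (s'⁻¹ * s)).2 ?_
        intro j t ht
        change s'.1.1⁻¹ (s.1.1 (axisPoint b j t)) = axisPoint b j t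
        rw [Equiv.Perm.inv_eq_iff_eq]
        have a1 := hθ s j (Units.mk0 t ht)
        have a2 := hθ s' j (Units.mk0 t ht)
        rw [hθeq] at a1
        exact a1.trans a2.symm
      have : s'⁻¹ * s = 1 := Subtype.ext (Subtype.ext hone)
      exact (inv_mul_eq_one.1 this).symm
    refine (Nat.card_le_card_of_injective _ this).trans_eq ?_
    rw [Nat.card_fun, Nat.card_eq_fintype_card, Fintype.card_embedding_eq, Nat.card_fin,
      Nat.descFactorial_self, ← Nat.card_eq_fintype_card, Nat.card_units]
  rw [horb]
  exact Nat.mul_le_mul h1 h2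

end basis

end Projectivization

namespace PolarForm

variable {K V : Type*} [Field K] [AddCommGroup V] [Module K V] {F : PolarForm K V}
variable {M : Submodule K V}

namespace IsGenerator

/-! ### Isomorphisms between twisted graphs -/

variable (hM : F.IsGenerator M) [Finite K] [FiniteDimensional K V]

include hM in
/-- Collineations of the dual space map pencils of hyperplanes through a point to such pencils. -/
lemma not_scatters_of_isCollineation {τ : Equiv.Perm (ℙ K (Module.Dual K M))}
    (hτ : Projectivization.IsCollineation τ) {m : F.Point} (hm : m.vec ∈ M) :
    ¬ F.Scatters M τ m := by
  intro h
  set W := LinearMap.ker (Module.Dual.eval K M ⟨m.vec, hm⟩) with hW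
  have hinc : ∀ H : ℙ K (Module.Dual K M), F.Inc M m (τ H) ↔ H.rep ∈ hτ.comap W := by
    intro H
    rw [hτ.rep_mem_comap, inc_iff hm]
    rfl
  obtain ⟨H₀, -, hH₀⟩ := (exists_inc_not_of_scatters hm hm h).1
  rw [hinc] at hH₀
  obtain ⟨f, hf, hle⟩ := Submodule.exists_le_ker_of_notMem hH₀
  obtain ⟨a, rfl⟩ := (Module.evalEquiv K M).surjective f
  have ha : a ≠ 0 := by rintro rfl; simp at hf
  obtain ⟨m', hm', hg⟩ := hM.exists_inc_vec ha
  obtain ⟨H, hH, hH'⟩ := (exists_inc_not_of_scatters hm hm' h).2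
  rw [hinc] at hH
  exact hH' ((inc_iff hm').2 ((hg _).2 (hle hH)))

lemma card_dual : Nat.card (ℙ K (Module.Dual K M)) =
    gnum (Nat.card K) (Module.finrank K M) := by
  have := card_projectivization_mem (K := K) (E := Module.Dual K M) ⊤
  rw [finrank_top, Subspace.dual_finrank_eq] at this
  rw [← this]
  exact Nat.card_congr (Equiv.subtypeUnivEquiv (by simp)).symm

include hM in
lemma ncard_points : {x : F.Point | x.vec ∈ M}.ncard =
    gnum (Nat.card K) (Module.finrank K M) := by
  rw [← Nat.card_coe_set_eq]
  exact F.card_points_le hM.ts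

variable [Fintype F.Point]
  [Fintype (ℙ K (Module.Dual K M))] [Nonempty (ℙ K (Module.Dual K M))]
  (hd : 2 ≤ Module.finrank K M) {τ ρ : Equiv.Perm (ℙ K (Module.Dual K M))}

/-- If `τ` scatters all points of `M`, then `M` can be recognized in the twisted graph as the only
clique of its size all of whose edges lie on full lines. -/
lemma eq_of_clique (hF : F.data.Nondeg) (hτ : ∀ m : F.Point, m.vec ∈ M → F.Scatters M τ m)
    {C : Set F.Point} (hcard : C.ncard = {x : F.Point | x.vec ∈ M}.ncard)
    (hadj : ∀ x ∈ C, ∀ y ∈ C, x ≠ y → (hM.twist hd τ).Adj x y)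
    (hline : ∀ x ∈ C, ∀ y ∈ C, x ≠ y → Nat.card K + 1 ≤ ((hM.twist hd τ).line x y).ncard) :
    C = {x | x.vec ∈ M} := by
  have hq : 1 < Nat.card K := Finite.one_lt_card
  by_cases hCM : ∃ m ∈ C, m.vec ∈ M
  · obtain ⟨m, hmC, hm⟩ := hCM
    refine Set.eq_of_subset_of_ncard_le (fun x hx => ?_) hcard.ge (Set.toFinite _)
    by_contra hxM
    have hne : m ≠ x := by rintro rfl; exact hxM hm
    have h1 := hline m hmC x hx hne
    have h2 := hM.ncard_line_le_two hd hF hm hxM (hadj m hmC x hx hne) (hτ m hm)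
    omega
  · exfalso
    push Not at hCM
    have heq : ∀ x ∈ C, ∀ y ∈ C, (hM.twist hd τ).EqOrAdj x y := fun x hx y hy =>
      (em (x = y)).imp id (hadj x hx y hy)
    have hperp : ∀ x ∈ C, ∀ y ∈ C, x.Perp y := fun x hx y hy =>
      (hM.eqOrAdj_out hd (hCM x hx) (hCM y hy)).1 (heq x hx y hy)
    have hinj : Set.InjOn (F.hyp M) C := by
      intro x hx y hy h
      by_contra hne
      exact (hline y hy x hx (Ne.symm hne)).not_gt (hM.ncard_line_lt hd hF hτ (hCM y hy) (hCM x hx)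
        hne (hperp y hy x hx) h)
    have hsurj : ∀ H, ∃ x ∈ C, F.hyp M x = H := by
      have h1 : (F.hyp M '' C) = Set.univ := by
        refine Set.eq_of_subset_of_ncard_le (Set.subset_univ _) ?_ (Set.toFinite _)
        rw [hinj.ncard_image, hcard, hM.ncard_points, Set.ncard_univ, card_dual]
      intro H
      have : H ∈ F.hyp M '' C := h1 ▸ Set.mem_univ H
      exact this
    obtain ⟨m, hm⟩ : ∃ m : F.Point, m.vec ∈ M := by
      have : 0 < {x : F.Point | x.vec ∈ M}.ncard := by
        rw [hM.ncard_points]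
        exact (Nat.zero_le _).trans_lt
          (gnum_lt_gnum (m := 0) Nat.card_pos (by omega))
      exact Set.nonempty_of_ncard_ne_zero this.ne'
    refine hM.not_scatters_of_isCollineation (τ := τ) (fun a b c habc => ?_) hm (hτ m hm)
    obtain ⟨x, hx, rfl⟩ := hsurj a
    obtain ⟨y, hy, rfl⟩ := hsurj b
    by_cases hxy : F.hyp M x = F.hyp M y
    · rw [← hxy] at habc ⊢
      rw [hM.mem_span_rep_iff] at habc
      rw [hM.eq_of_inc fun m hm h => habc m hm h h]
      exact Submodule.subset_span (by simp)
    have hne : x ≠ y := by rintro rfl; exact hxy rfl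
    have hlineM : ∀ z ∈ (hM.twist hd τ).line x y, z.vec ∉ M := by
      intro z hz hzM
      obtain ⟨H, -, hH⟩ := (exists_inc_not_of_scatters hzM hzM (hτ z hzM)).1
      obtain ⟨w, hw, rfl⟩ := hsurj H
      exact hH ((hM.eqOrAdj_mixed hd hzM (hCM w hw)).1
        (hz w (heq w hw x hx) (heq w hw y hy)).symm)
    have hfull : (hM.twist hd τ).line x y =
        {z : F.Point | z.vec ∈ Submodule.span K {x.vec, y.vec}} := by
      refine Set.eq_of_subset_of_ncard_le (fun z hz => ?_) ?_ (Set.toFinite _)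
      · exact hM.mem_span_of_mem_line hd hF (hCM x hx) (hCM y hy) (hperp x hx y hy) (hlineM z hz) hz
      · rw [ncard_span_pair hne (hperp x hx y hy)]
        exact hline x hx y hy hne
    obtain ⟨z, hz, hzl, rfl⟩ := hM.exists_mem_span_hyp_eq (hCM x hx) (hCM y hy) (hperp x hx y hy)
      hxy habc
    rw [hM.mem_span_rep_iff]
    intro p hp h1 h2
    have hz' : z ∈ (hM.twist hd τ).line x y := by rw [hfull]; exact hzl
    exact (hM.eqOrAdj_mixed hd hp hz).1 (hz' p ((hM.eqOrAdj_mixed hd hp (hCM x hx)).2 h1)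
      ((hM.eqOrAdj_mixed hd hp (hCM y hy)).2 h2))

/-- An isomorphism between graphs twisted by scattering permutations fixes `M`. Its action on `M`
and its action on the hyperplanes attached to the vertices outside `M` are collineations, which
relate the two permutations. -/
lemma exists_collineations_of_iso (hF : F.data.Nondeg)
    (hρ : ∀ m : F.Point, m.vec ∈ M → F.Scatters M ρ m)
    (g : hM.twist hd τ ≃g hM.twist hd ρ) :
    ∃ α ∈ Projectivization.collineations K (Module.Dual K M),
      ∃ β ∈ Projectivization.collineations K (Module.Dual K M), ρ * β = α * τ := by
  classical
  have hgM : g '' {x | x.vec ∈ M} = {x | x.vec ∈ M} := by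
    refine hM.eq_of_clique hd hF hρ (Set.ncard_image_of_injective _ g.injective) ?_ ?_
    · rintro _ ⟨x, hx, rfl⟩ _ ⟨y, hy, rfl⟩ hne
      rw [g.map_adj_iff]
      exact (hM.adj_in hd hx hy).2 fun h => hne (h ▸ rfl)
    · rintro _ ⟨x, hx, rfl⟩ _ ⟨y, hy, rfl⟩ hne
      rw [g.ncard_line]
      exact hM.le_ncard_line_in hd hx hy fun h => hne (h ▸ rfl)
  have hin : ∀ x : F.Point, (g x).vec ∈ M ↔ x.vec ∈ M := by
    intro x
    have : g x ∈ g '' {x : F.Point | x.vec ∈ M} ↔ _ := g.injective.mem_set_image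
    rw [hgM] at this
    exact this
  have hsurj : ∀ p : F.Point, p.vec ∈ M → ∃ m : F.Point, m.vec ∈ M ∧ g m = p := by
    intro p hp
    have : p ∈ g '' {x : F.Point | x.vec ∈ M} := by rw [hgM]; exact hp
    exact this
  have hinc : ∀ m x : F.Point, m.vec ∈ M → x.vec ∉ M →
      (F.Inc M (g m) (ρ (F.hyp M (g x))) ↔ F.Inc M m (τ (F.hyp M x))) := by
    intro m x hm hx
    rw [← hM.adj_mixed hd hm hx, ← g.map_adj_iff,
      hM.adj_mixed hd ((hin m).2 hm) (fun h => hx ((hin x).1 h))]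
  have hperp : ∀ x y : F.Point, x.vec ∉ M → y.vec ∉ M → ((g x).Perp (g y) ↔ x.Perp y) := by
    intro x y hx hy
    rw [← hM.eqOrAdj_out hd (τ := τ) hx hy, ← g.eqOrAdj_iff,
      hM.eqOrAdj_out hd (fun h => hx ((hin x).1 h)) (fun h => hy ((hin y).1 h))]
  have hhyp : ∀ x y : F.Point, x.vec ∉ M → y.vec ∉ M →
      (F.hyp M (g x) = F.hyp M (g y) ↔ F.hyp M x = F.hyp M y) := by
    intro x y hx hy
    constructor
    · intro h
      refine τ.injective (hM.eq_of_inc fun m hm hi => ?_)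
      rwa [← hinc m x hm hx, h, hinc m y hm hy] at hi
    · intro h
      refine ρ.injective (hM.eq_of_inc fun p hp hi => ?_)
      obtain ⟨m, hm, rfl⟩ := hsurj p hp
      rwa [hinc m x hm hx, h, ← hinc m y hm hy] at hi
  choose pt hptM hpt using hM.exists_hyp_eq hF
  have hβinj : Function.Injective fun H => F.hyp M (g (pt H)) := by
    intro H H' h
    have := (hhyp _ _ (hptM H) (hptM H')).1 h
    rwa [hpt, hpt] at this
  set β : Equiv.Perm (ℙ K (Module.Dual K M)) :=
    Equiv.ofBijective _ (Finite.injective_iff_bijective.1 hβinj) with hβ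
  have hβx : ∀ x : F.Point, x.vec ∉ M → β (F.hyp M x) = F.hyp M (g x) := by
    intro x hx
    exact (hhyp _ _ (hptM _) hx).2 (hpt _)
  have hα : ∀ m H, m.vec ∈ M → (F.Inc M (g m) ((ρ * β * τ⁻¹) H) ↔ F.Inc M m H) := by
    intro m H hm
    obtain ⟨x, hx, hxH⟩ := hM.exists_hyp_eq hF (τ⁻¹ H)
    rw [Equiv.Perm.mul_apply, Equiv.Perm.mul_apply, ← hxH, hβx x hx, hinc m x hm hx, hxH,
      show τ (τ⁻¹ H) = H by simp]
  refine ⟨ρ * β * τ⁻¹, ?_, β, ?_, by group⟩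
  · intro a b c habc
    rw [hM.mem_span_rep_iff] at habc ⊢
    intro p hp
    obtain ⟨m, hm, rfl⟩ := hsurj p hp
    rw [hα m a hm, hα m b hm, hα m c hm]
    exact habc m hm
  · intro a b c habc
    by_cases hab : b = a
    · subst hab
      rw [hM.mem_span_rep_iff] at habc
      rw [hM.eq_of_inc fun m hm h => habc m hm h h]
      exact Submodule.subset_span (by simp)
    obtain ⟨x, hx, rfl⟩ := hM.exists_hyp_eq hF a
    obtain ⟨y, hy, rfl, hxy⟩ := hM.exists_perp_hyp_eq hF hx hab
    obtain ⟨z, hz, hzl, rfl⟩ := hM.exists_mem_span_hyp_eq hx hy hxy (Ne.symm hab) habc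
    have hout : ∀ w : F.Point, w.vec ∉ M → (g w).vec ∉ M := fun w hw h => hw ((hin w).1 h)
    rw [hβx x hx, hβx y hy, hβx z hz]
    refine hM.hyp_mem_span (hout x hx) (hout y hy) (hout z hz) ?_
    refine mem_span_of_forall_perp hF (hout x hx) (hout y hy) ((hperp x y hx hy).2 hxy) ?_
    intro w hw hwx hwy
    obtain ⟨w, rfl⟩ := g.surjective w
    have hw' : w.vec ∉ M := fun h => hw ((hin w).2 h)
    rw [hperp _ _ hw' hx] at hwx
    rw [hperp _ _ hw' hy] at hwy
    rw [hperp _ _ hw' hz]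
    obtain ⟨s, t, hst⟩ := Submodule.mem_span_pair.1 hzl
    rw [Point.Perp, ← hst, map_add, map_smul, map_smul, hwx, hwy, smul_zero, smul_zero, add_zero]

end IsGenerator

end PolarForm

/-! ### Estimates -/

lemma gnum_lt_pow (q n : ℕ) (hq : 2 ≤ q) : gnum q n < q ^ n := by
  have := gnum_mul q n (by omega)
  have h : gnum q n * 1 ≤ gnum q n * (q - 1) := Nat.mul_le_mul_left _ (by omega)
  omega

lemma two_mul_sq_le_choose {N h : ℕ} (hN : 13 ≤ N) (h4 : 4 ≤ h) (hh : 2 * h ≤ N) :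
    2 * N ^ 2 ≤ N.choose h := by
  have hmono : N.choose 4 ≤ N.choose h := by
    induction h, h4 using Nat.le_induction with
    | base => exact le_rfl
    | succ k hk ih =>
      exact (ih (by omega)).trans (Nat.choose_le_succ_of_lt_half_left (by omega))
  refine le_trans ?_ hmono
  have h1 := Nat.descFactorial_eq_factorial_mul_choose N 4
  obtain ⟨k, rfl⟩ := Nat.exists_eq_add_of_le' hN
  simp only [Nat.descFactorial_succ, Nat.descFactorial_zero, Nat.factorial] at h1
  have e3 : k + 13 - 3 = k + 10 := by omega
  have e2 : k + 13 - 2 = k + 11 := by omega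
  have e1 : k + 13 - 1 = k + 12 := by omega
  rw [e3, e2, e1] at h1
  simp only [Nat.sub_zero, mul_one] at h1
  have h2 : Nat.succ 3 * (Nat.succ 2 * (Nat.succ 1 * Nat.succ 0)) = 24 := rfl
  have h3 : (k + 10) * ((k + 11) * ((k + 12) * (k + 13))) =
      48 * (k + 13) ^ 2 + (k ^ 3 + 33 * k ^ 2 + 314 * k + 696) * (k + 13) := by ring
  rw [h2, h3] at h1
  omega

lemma factorial_succ_le_pow (k : ℕ) : (k + 1)! ≤ (k + 2) ^ k := by
  induction k with
  | zero => simp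
  | succ k ih =>
    rw [Nat.factorial_succ, pow_succ']
    refine Nat.mul_le_mul (by omega) (ih.trans (Nat.pow_le_pow_left (by omega) _))

/-- A lower bound for `N! / (q ^ r)!`, where `N` is the number of points of a projective space of
vector space dimension `r + 2`. -/
lemma factorial_mul_pow_le_factorial_gnum {q r : ℕ} (hq : 2 ≤ q) (hr : 1 ≤ r) :
    (q ^ r)! * q ^ (r * q ^ (r + 1) + q ^ r + r + 2) ≤ (gnum q (r + 2))! := by
  have hlt : q ^ r < q ^ (r + 1) := Nat.pow_lt_pow_right (by omega) (by omega)
  obtain ⟨s, hs⟩ := Nat.exists_eq_add_of_lt hlt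
  have h1 : (q ^ r)! * (q ^ r) ^ s ≤ (q ^ r + s)! :=
    (Nat.mul_le_mul_left _ (Nat.pow_le_pow_left (by omega) _)).trans
      Nat.factorial_mul_pow_le_factorial
  obtain ⟨t, ht⟩ : ∃ t, gnum q (r + 2) = q ^ r + s + t ∧ q ^ r + 2 ≤ t := by
    refine ⟨gnum q (r + 2) - (q ^ r + s), ?_⟩
    obtain ⟨r', rfl⟩ := Nat.exists_eq_add_of_le' hr
    have e1 : gnum q (r' + 1 + 2) = gnum q (r' + 1 + 1) + q ^ (r' + 1 + 1) := gnum_succ _ _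
    have e2 := gnum_succ q (r' + 1)
    have e3 := gnum_succ' q r'
    omega
  have h2 : (q ^ r + s)! * (q ^ r + s + 1) ^ t ≤ (q ^ r + s + t)! :=
    Nat.factorial_mul_pow_le_factorial
  rw [← hs] at h2
  rw [ht.1]
  refine le_trans ?_ h2
  refine le_trans ?_ (Nat.mul_le_mul_right _ h1)
  rw [mul_assoc, ← pow_mul, ← pow_mul, ← pow_add]
  refine Nat.mul_le_mul_left _ (Nat.pow_le_pow_right (by omega) ?_)
  have h3 : (r + 1) * (q ^ r + 2) ≤ (r + 1) * t := Nat.mul_le_mul_left _ ht.2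
  have h4 : r * q ^ (r + 1) = r * q ^ r + r * s + r := by rw [hs]; ring
  nlinarith

lemma exponent_le {q r : ℕ} (hq : 2 ≤ q) (hr : 1 ≤ r) (h1 : r = 1 → 5 ≤ q) (h2 : r = 2 → 3 ≤ q) :
    1 + 2 * (r + 2) ^ 2 + 2 * (r + 1) * (q - 2) ≤ r * q ^ (r + 1) + q ^ r + r + 2 := by
  obtain ⟨t, rfl⟩ := Nat.exists_eq_add_of_le' hq
  rw [Nat.add_sub_cancel]
  rcases (by omega : r = 1 ∨ r = 2 ∨ 3 ≤ r) with rfl | rfl | hr3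
  · have := h1 rfl
    obtain ⟨u, rfl⟩ := Nat.exists_eq_add_of_le' (show 3 ≤ t by omega)
    ring_nf; nlinarith
  · have := h2 rfl
    obtain ⟨u, rfl⟩ := Nat.exists_eq_add_of_le' (show 1 ≤ t by omega)
    ring_nf
    nlinarith [pow_pos (show 0 < u + 1 by omega) 3, sq_nonneg u, Nat.zero_le (u ^ 3)]
  · have hpow : 2 * r + 2 ≤ 2 ^ r := by
      clear h1 h2 hr
      induction r, hr3 using Nat.le_induction with
      | base => norm_num
      | succ k hk ih => rw [pow_succ]; omega
    have hA : 2 * r + 2 ≤ (t + 2) ^ r := hpow.trans (Nat.pow_le_pow_left (by omega) _)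
    rw [pow_succ (t + 2) r]
    generalize (t + 2) ^ r = A at hA
    have hB : r * ((2 * r + 2) * (t + 2)) ≤ r * (A * (t + 2)) :=
      Nat.mul_le_mul_left _ (Nat.mul_le_mul_right _ hA)
    have hC : 2 * (r + 1) * t ≤ r * ((2 * r + 2) * t) := by nlinarith [Nat.zero_le (r * t)]
    nlinarith

/-- The permutations of the points of a projective space outnumber `(q ^ (d - 2))!` double cosets
of the group of collineations. -/
lemma two_mul_le_factorial_gnum {q d : ℕ} (hq : 2 ≤ q) (hd : 3 ≤ d) (h : ¬ (q = 2 ∧ d = 3)) :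
    2 * ((q ^ (d - 2))! * (gnum q d ^ d * ((q - 1)!) ^ (d - 1)) ^ 2) ≤ (gnum q d)! := by
  by_cases h33 : q = 3 ∧ d = 3
  · obtain ⟨rfl, rfl⟩ := h33
    simp [gnum, Finset.sum_range_succ, Nat.factorial]
  by_cases h43 : q = 4 ∧ d = 3
  · obtain ⟨rfl, rfl⟩ := h43
    simp [gnum, Finset.sum_range_succ, Nat.factorial]
  by_cases h24 : q = 2 ∧ d = 4
  · obtain ⟨rfl, rfl⟩ := h24
    simp [gnum, Finset.sum_range_succ, Nat.factorial]
  obtain ⟨r, rfl⟩ := Nat.exists_eq_add_of_le' (show 2 ≤ d by omega)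
  obtain ⟨k, rfl⟩ := Nat.exists_eq_add_of_le' hq
  refine le_trans ?_ (factorial_mul_pow_le_factorial_gnum hq (r := r) (by omega))
  rw [Nat.add_sub_cancel, mul_left_comm]
  refine Nat.mul_le_mul_left _ ?_
  refine le_trans ?_ (Nat.pow_le_pow_right (by omega)
    (exponent_le hq (r := r) (by omega) (by omega) (by omega)))
  have e1 : gnum (k + 2) (r + 2) ^ (r + 2) ≤ (k + 2) ^ ((r + 2) * (r + 2)) := by
    rw [pow_mul]
    exact Nat.pow_le_pow_left (gnum_lt_pow _ _ hq).le _
  have e2 : ((k + 2 - 1)!) ^ (r + 2 - 1) ≤ (k + 2) ^ (k * (r + 1)) := by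
    rw [pow_mul]
    exact Nat.pow_le_pow_left (factorial_succ_le_pow k) _
  calc 2 * (gnum (k + 2) (r + 2) ^ (r + 2) * ((k + 2 - 1)!) ^ (r + 2 - 1)) ^ 2
      ≤ (k + 2) * ((k + 2) ^ ((r + 2) * (r + 2)) * (k + 2) ^ (k * (r + 1))) ^ 2 :=
        Nat.mul_le_mul hq (Nat.pow_le_pow_left (Nat.mul_le_mul e1 e2) _)
    _ = (k + 2) ^ (1 + 2 * (r + 2) ^ 2 + 2 * (r + 1) * (k + 2 - 2)) := by
        rw [Nat.add_sub_cancel]; ring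

/-! ### Counting scattering permutations and isomorphism classes -/

/-- Few permutations map a given subset onto another given subset. -/
lemma card_perm_iff_le {D : Type*} [Finite D] (p r : D → Prop) :
    Nat.card {τ : Equiv.Perm D // ∀ H, p H ↔ r (τ H)} ≤
      (Nat.card {H // p H})! * (Nat.card D - Nat.card {H // p H})! := by
  classical
  have : Fintype D := Fintype.ofFinite D
  rcases isEmpty_or_nonempty {τ : Equiv.Perm D // ∀ H, p H ↔ r (τ H)} with hE | ⟨⟨τ₀, h₀⟩⟩
  · simp
  have hmem : ∀ τ : {τ : Equiv.Perm D // ∀ H, p H ↔ r (τ H)}, ∀ H, p ((τ₀⁻¹ * τ.1) H) ↔ p H := by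
    intro τ H
    rw [h₀, τ.2 H]
    simp
  have hinj : Function.Injective (fun τ : {τ : Equiv.Perm D // ∀ H, p H ↔ r (τ H)} =>
      ((τ₀⁻¹ * τ.1).subtypePerm (hmem τ),
        (τ₀⁻¹ * τ.1).subtypePerm (p := fun H => ¬ p H) (fun H => not_congr (hmem τ H)))) := by
    intro τ τ' h
    rw [Prod.mk.injEq] at h
    refine Subtype.ext (mul_left_cancel (a := τ₀⁻¹) (Equiv.ext fun H => ?_))
    by_cases hH : p H
    · exact congrArg Subtype.val (Equiv.congr_fun h.1 ⟨H, hH⟩)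
    · exact congrArg Subtype.val (Equiv.congr_fun h.2 ⟨H, hH⟩)
  refine (Nat.card_le_card_of_injective _ hinj).trans_eq ?_
  rw [Nat.card_prod, Nat.card_perm, Nat.card_perm]
  congr 2
  have := Nat.card_congr (Equiv.sumCompl p)
  rw [Nat.card_sum] at this
  omega

/-- If every class of an equivalence relation meets the finite set `W` in at most `c` elements,
then `W` contains `n` pairwise inequivalent elements as soon as it has at least `n * c` elements. -/
lemma exists_pairwise_not_rel {α : Type*} (s : Setoid α) (W : Finset α) {n c : ℕ} (hc : 0 < c)
    (hfib : ∀ a ∈ W, ∀ T ⊆ W, (∀ x ∈ T, s.r a x) → T.card ≤ c) (hW : n * c ≤ W.card) :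
    ∃ f : Fin n → α, ∀ i j, i ≠ j → ¬ s.r (f i) (f j) := by
  classical
  have h1 : W.card ≤ c * (W.image (Quotient.mk s)).card := by
    refine Finset.card_le_mul_card_image W c fun b hb => ?_
    obtain ⟨a, ha, rfl⟩ := Finset.mem_image.1 hb
    refine hfib a ha _ (Finset.filter_subset _ _) fun x hx => ?_
    exact s.symm (Quotient.exact (Finset.mem_filter.1 hx).2)
  have h2 : n ≤ (W.image (Quotient.mk s)).card := by
    rw [mul_comm n] at hW
    exact Nat.le_of_mul_le_mul_left (hW.trans h1) hc
  obtain ⟨T, hT, hTn⟩ := Finset.exists_subset_card_eq h2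
  have e : Fin n ≃ T := (Fintype.equivFinOfCardEq (by simpa using hTn)).symm
  refine ⟨fun i => (e i).1.out, fun i j hij h => hij (e.injective (Subtype.ext ?_))⟩
  have := Quotient.sound (s := s) h
  rwa [Quotient.out_eq, Quotient.out_eq] at this

namespace PolarForm

variable {K V : Type*} [Field K] [AddCommGroup V] [Module K V] {F : PolarForm K V}
variable {M : Submodule K V}

namespace IsGenerator

variable (hM : F.IsGenerator M) [Finite K] [FiniteDimensional K V] [Fintype F.Point]
  [Fintype (ℙ K (Module.Dual K M))]

include hM in
open Classical in
/-- At least half of all permutations of the hyperplanes scatter all points. -/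
lemma card_scatters (h13 : 13 ≤ gnum (Nat.card K) (Module.finrank K M))
    (h4 : 4 ≤ gnum (Nat.card K) (Module.finrank K M - 1)) (hd : 1 ≤ Module.finrank K M) :
    (gnum (Nat.card K) (Module.finrank K M))! ≤
      2 * (Finset.univ.filter fun τ : Equiv.Perm (ℙ K (Module.Dual K M)) =>
        ∀ m : F.Point, m.vec ∈ M → F.Scatters M τ m).card := by
  set N := gnum (Nat.card K) (Module.finrank K M) with hN
  set h := gnum (Nat.card K) (Module.finrank K M - 1) with hh
  set X := Finset.univ.filter fun m : F.Point => m.vec ∈ M with hX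
  have hXcard : X.card = N := by
    rw [hX, card_filter_eq_natCard]; exact F.card_points_le hM.ts
  have hq : 2 ≤ Nat.card K := Finite.one_lt_card
  have hNh : N = Nat.card K * h + 1 := by
    rw [hN, hh, ← gnum_succ', Nat.sub_add_cancel hd]
  have h2h : 2 * h ≤ N := by nlinarith
  have hall : (Finset.univ : Finset (Equiv.Perm (ℙ K (Module.Dual K M)))).card = N ! := by
    rw [Finset.card_univ, Fintype.card_perm, ← Nat.card_eq_fintype_card, card_dual]
  rw [← Finset.card_filter_add_card_filter_not
    (fun τ : Equiv.Perm (ℙ K (Module.Dual K M)) => ∀ m : F.Point, m.vec ∈ M → F.Scatters M τ m)]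
    at hall
  have hbad : (Finset.univ.filter fun τ : Equiv.Perm (ℙ K (Module.Dual K M)) =>
      ¬ ∀ m : F.Point, m.vec ∈ M → F.Scatters M τ m).card ≤ N ^ 2 * (h ! * (N - h)!) := by
    have hsub : (Finset.univ.filter fun τ : Equiv.Perm (ℙ K (Module.Dual K M)) =>
        ¬ ∀ m : F.Point, m.vec ∈ M → F.Scatters M τ m) ⊆
        (X ×ˢ X).biUnion fun x => Finset.univ.filter fun τ => ∀ H,
          F.Inc M x.2 H ↔ F.Inc M x.1 (τ H) := by
      intro τ hτ
      rw [Finset.mem_filter] at hτ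
      obtain ⟨m, hm, hs⟩ : ∃ m : F.Point, m.vec ∈ M ∧ ¬ F.Scatters M τ m := by
        simpa using hτ.2
      obtain ⟨m', hm', hs'⟩ : ∃ m' : F.Point, m'.vec ∈ M ∧
          ∀ H, F.Inc M m' H ↔ F.Inc M m (τ H) := by
        simpa [Scatters] using hs
      rw [Finset.mem_biUnion]
      exact ⟨(m, m'), by simp [hX, hm, hm'], by simpa using hs'⟩
    refine (Finset.card_le_card hsub).trans ?_
    refine (Finset.card_biUnion_le_card_mul _ _ (h ! * (N - h)!) fun x hx => ?_).trans_eq ?_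
    · rw [Finset.mem_product, hX, Finset.mem_filter, Finset.mem_filter] at hx
      rw [card_filter_eq_natCard]
      refine (card_perm_iff_le (F.Inc M x.2) (F.Inc M x.1)).trans_eq ?_
      rw [card_inc hx.2.2, card_dual]
    · rw [Finset.card_product, hXcard, sq]
  have hch : 2 * N ^ 2 * (h ! * (N - h)!) ≤ N ! := by
    rw [← Nat.choose_mul_factorial_mul_factorial (show h ≤ N by omega), mul_assoc (N.choose h)]
    exact Nat.mul_le_mul_right _ (two_mul_sq_le_choose h13 h4 h2h)
  rw [mul_assoc] at hch
  omega

variable [Nonempty (ℙ K (Module.Dual K M))] (hd : 2 ≤ Module.finrank K M)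

lemma twist_ne_top (hF : F.data.Nondeg) (τ : Equiv.Perm (ℙ K (Module.Dual K M))) :
    hM.twist hd τ ≠ ⊤ := by
  intro h
  obtain ⟨x, hx, -⟩ := hM.exists_hyp_eq hF (Classical.arbitrary _)
  obtain ⟨m, hm, hmx⟩ := hM.exists_not_inc (τ (F.hyp M x))
  rw [← hM.adj_mixed hd hm hx, h] at hmx
  exact hmx fun e => hx (e ▸ hm)

lemma twist_ne_bot (τ : Equiv.Perm (ℙ K (Module.Dual K M))) : hM.twist hd τ ≠ ⊥ := by
  intro h
  have h1 : 1 < {x : F.Point | x.vec ∈ M}.ncard := by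
    rw [hM.ncard_points]
    refine lt_of_eq_of_lt ?_ (gnum_lt_gnum (m := 1) Nat.card_pos (by omega))
    simp [gnum]
  obtain ⟨m, hm, m', hm', hne⟩ := (Set.one_lt_ncard (Set.toFinite _)).1 h1
  rw [← hM.adj_in hd hm hm' (τ := τ), h] at hne
  exact hne

/-- Many permutations give nonisomorphic graphs, since the isomorphism class of a graph twisted by
a scattering permutation `τ` only involves permutations in the double coset of `τ` with respect to
the group of collineations. -/
lemma exists_pairwise_not_iso (hF : F.data.Nondeg) {n : ℕ}
    (h13 : 13 ≤ gnum (Nat.card K) (Module.finrank K M))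
    (h4 : 4 ≤ gnum (Nat.card K) (Module.finrank K M - 1))
    (hn : 2 * (n * (gnum (Nat.card K) (Module.finrank K M) ^ Module.finrank K M *
      ((Nat.card K - 1)!) ^ (Module.finrank K M - 1)) ^ 2) ≤
      (gnum (Nat.card K) (Module.finrank K M))!) :
    ∃ f : Fin n → Equiv.Perm (ℙ K (Module.Dual K M)),
      ∀ i j, i ≠ j → IsEmpty (hM.twist hd (f i) ≃g hM.twist hd (f j)) := by
  classical
  let s : Setoid (Equiv.Perm (ℙ K (Module.Dual K M))) :=
    { r := fun τ ρ => Nonempty (hM.twist hd τ ≃g hM.twist hd ρ)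
      iseqv := ⟨fun _ => ⟨SimpleGraph.Iso.refl⟩, fun ⟨g⟩ => ⟨g.symm⟩,
        fun ⟨g⟩ ⟨g'⟩ => ⟨g.trans g'⟩⟩ }
  set Γ := Projectivization.collineations K (Module.Dual K M) with hΓ
  have hΓcard : Nat.card Γ ≤ gnum (Nat.card K) (Module.finrank K M) ^ Module.finrank K M *
      ((Nat.card K - 1)!) ^ (Module.finrank K M - 1) := by
    have h1 : Module.finrank K (Module.Dual K M) = (Module.finrank K M - 1) + 1 := by
      rw [Subspace.dual_finrank_eq]; omega
    have := Projectivization.card_collineations_le (Module.finBasisOfFinrankEq _ _ h1)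
    rwa [card_dual, Nat.sub_add_cancel (by omega)] at this
  have hW := hM.card_scatters h13 h4 (by omega)
  have hex : ∃ f : Fin n → Equiv.Perm (ℙ K (Module.Dual K M)), ∀ i j, i ≠ j → ¬ s.r (f i) (f j) := by
    refine exists_pairwise_not_rel s (Finset.univ.filter
      fun τ : Equiv.Perm (ℙ K (Module.Dual K M)) => ∀ m : F.Point, m.vec ∈ M → F.Scatters M τ m)
      (c := Nat.card Γ ^ 2) (pow_pos Nat.card_pos 2) ?_ ?_
    · intro τ _ T hT hr
      have hsub : T ⊆ (Finset.univ : Finset (Γ × Γ)).image fun x => x.1.1 * τ * x.2.1⁻¹ := by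
        intro ρ hρ
        obtain ⟨g⟩ := hr ρ hρ
        obtain ⟨α, hα, β, hβ, h⟩ :=
          hM.exists_collineations_of_iso hd hF (Finset.mem_filter.1 (hT hρ)).2 g
        rw [Finset.mem_image]
        exact ⟨(⟨α, hα⟩, ⟨β, hβ⟩), Finset.mem_univ _, by rw [← h, mul_inv_cancel_right]⟩
      refine (Finset.card_le_card hsub).trans (Finset.card_image_le.trans_eq ?_)
      rw [Finset.card_univ, ← Nat.card_eq_fintype_card, Nat.card_prod, sq]
    · have := Nat.mul_le_mul_left n (Nat.pow_le_pow_left hΓcard 2)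
      omega
  obtain ⟨f, hf⟩ := hex
  exact ⟨f, fun i j hij => not_nonempty_iff.1 (hf i j hij)⟩

/-- A transposition gives a graph that is not isomorphic to the collinearity graph. -/
lemma exists_not_iso (hF : F.data.Nondeg) (h3 : 3 ≤ Module.finrank K M) :
    ∃ τ, IsEmpty (hM.twist hd 1 ≃g hM.twist hd τ) := by
  classical
  have hq : 1 < Nat.card K := Finite.one_lt_card
  obtain ⟨b⟩ := ‹Nonempty (ℙ K (Module.Dual K M))›
  obtain ⟨m, hm, hmb⟩ := hM.exists_not_inc b
  have hcard : {H | F.Inc M m H}.ncard = gnum (Nat.card K) (Module.finrank K M - 1) :=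
    ncard_inc_perm hm 1
  have hgn : gnum (Nat.card K) (Module.finrank K M - 2) + 1 <
      gnum (Nat.card K) (Module.finrank K M - 1) := by
    obtain ⟨r, hr⟩ := Nat.exists_eq_add_of_le' h3
    rw [hr, show r + 3 - 1 = r + 1 + 1 by omega, show r + 3 - 2 = r + 1 by omega,
      gnum_succ _ (r + 1)]
    have : (Nat.card K) ^ 1 ≤ (Nat.card K) ^ (r + 1) :=
      Nat.pow_le_pow_right (by omega) (by omega)
    rw [pow_one] at this
    omega
  obtain ⟨a, ha⟩ : {H | F.Inc M m H}.Nonempty :=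
    Set.nonempty_of_ncard_ne_zero (by omega)
  have hab : a ≠ b := by rintro rfl; exact hmb ha
  -- A point with the same hyperplanes as `m`, apart from `a`, would share too many with `m`.
  have hs : F.Scatters M (Equiv.swap a b) m := by
    intro m' hm' h
    have hne : m ≠ m' := by
      rintro rfl
      have := h a
      rw [Equiv.swap_apply_left] at this
      exact hmb (this.1 ha)
    have h2 : {H | F.Inc M m H ∧ F.Inc M m' H}.ncard =
        gnum (Nat.card K) (Module.finrank K M - 2) := by
      rw [← card_inc_inc hm hm' hne, ← Nat.card_coe_set_eq]
      rfl
    have hsub : {H | F.Inc M m H} \ {a} ⊆ {H | F.Inc M m H ∧ F.Inc M m' H} := by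
      rintro H ⟨hH, hHa⟩
      refine ⟨hH, ?_⟩
      have hHb : H ≠ b := by rintro rfl; exact hmb hH
      rw [h H, Equiv.swap_apply_of_ne_of_ne hHa hHb]
      exact hH
    have h3 := Set.ncard_le_ncard hsub (Set.toFinite _)
    rw [Set.ncard_sdiff_singleton_of_mem ha, hcard, h2] at h3
    omega
  refine ⟨Equiv.swap a b, ⟨fun g => ?_⟩⟩
  obtain ⟨x, hx, hxb⟩ := hM.exists_hyp_eq hF b
  have hadj : (hM.twist hd (Equiv.swap a b)).Adj m x := by
    rw [hM.adj_mixed hd hm hx, hxb, Equiv.swap_apply_right]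
    exact ha
  have hle := hM.ncard_line_le_two hd hF hm hx hadj hs
  obtain ⟨m, rfl⟩ := g.surjective m
  obtain ⟨x, rfl⟩ := g.surjective x
  rw [g.map_adj_iff, twist_one, F.adj_iff] at hadj
  rw [g.ncard_line, twist_one] at hle
  have : Nat.card K + 1 ≤ (F.collinearityGraph.line m x).ncard := by
    rw [← ncard_span_pair hadj.1 hadj.2]
    refine Set.ncard_le_ncard (fun z hz w h1 h2 => ?_) (Set.toFinite _)
    have heq : ∀ y : F.Point, F.collinearityGraph.EqOrAdj w y ↔ w.Perp y := by
      intro y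
      rw [SimpleGraph.EqOrAdj, F.adj_iff]
      refine ⟨?_, fun h => (em (w = y)).imp id fun h' => ⟨h', h⟩⟩
      rintro (rfl | h)
      exacts [w.perp_self, h.2]
    rw [heq] at h1 h2 ⊢
    obtain ⟨s, t, hst⟩ := Submodule.mem_span_pair.1 hz
    rw [Point.Perp, ← hst, map_add, map_smul, map_smul, h1, h2, smul_zero, smul_zero, add_zero]
  omega

end IsGenerator

end PolarForm

theorem mainTheorem4 {K V : Type*} [Field K] [Finite K] [AddCommGroup V] [Module K V]
    [FiniteDimensional K V] (F : PolarForm K V) (hF : F.IsNondegenerate)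
    (q d : ℕ) (hq : Nat.card K = q) (hd : 3 ≤ d) (hrank : F.HasRank d) :
    ∃ v k l m : ℕ, IsStronglyRegular F.collinearityGraph v k l m ∧
      ∃ G : Fin ((q ^ (d - 2))!) → SimpleGraph F.Point,
        (∀ i, IsStronglyRegular (G i) v k l m) ∧
        ∀ i j, i ≠ j → IsEmpty (G i ≃g G j) := by
  classical
  subst hq
  have hq : 2 ≤ Nat.card K := Finite.one_lt_card
  obtain ⟨M, hM, rfl⟩ := F.exists_generator hrank
  have hE := F.nondeg hF
  have : Fintype F.Point := Fintype.ofFinite _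
  have : Finite (Module.Dual K M) := Module.finite_of_finite K
  have : Fintype (ℙ K (Module.Dual K M)) := Fintype.ofFinite _
  have hcardD := PolarForm.IsGenerator.card_dual (K := K) (M := M)
  have hpos : 0 < gnum (Nat.card K) (Module.finrank K M) :=
    (Nat.zero_le _).trans_lt (gnum_lt_gnum (m := 0) (by omega) (by omega))
  have : Nonempty (ℙ K (Module.Dual K M)) := by
    rw [← hcardD] at hpos
    exact (Nat.card_pos_iff.1 hpos).1
  have hd2 : 2 ≤ Module.finrank K M := by omega
  obtain ⟨k, l, μ, hG⟩ := F.exists_hasSRGCounts hE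
  have htw : ∀ τ, HasSRGCounts (hM.twist hd2 τ) k l μ := fun τ =>
    SwitchSystem.hasSRGCounts_twist (hM.switchSystem hd2) hG τ
  have hsrg : ∀ τ, IsStronglyRegular (hM.twist hd2 τ) (Nat.card F.Point) k l μ := fun τ =>
    (htw τ).isStronglyRegular (hM.twist_ne_top hd2 hE τ) (hM.twist_ne_bot hd2 τ)
  refine ⟨Nat.card F.Point, k, l, μ, ?_, ?_⟩
  · rw [← hM.twist_one hd2]
    exact hsrg 1
  suffices h : ∃ f : Fin ((Nat.card K ^ (Module.finrank K M - 2))!) →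
      Equiv.Perm (ℙ K (Module.Dual K M)),
      ∀ i j, i ≠ j → IsEmpty (hM.twist hd2 (f i) ≃g hM.twist hd2 (f j)) by
    obtain ⟨f, hf⟩ := h
    exact ⟨fun i => hM.twist hd2 (f i), fun i => hsrg _, hf⟩
  by_cases h23 : Nat.card K = 2 ∧ Module.finrank K M = 3
  · -- The counting argument is too weak here, but two graphs are enough.
    have h2 : (Nat.card K ^ (Module.finrank K M - 2))! = 2 := by
      rw [h23.1, h23.2]; rfl
    rw [h2]
    obtain ⟨τ, hτ⟩ := hM.exists_not_iso hd2 hE hd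
    refine ⟨![1, τ], fun i j hij => ?_⟩
    fin_cases i <;> fin_cases j
    · exact absurd rfl hij
    · exact hτ
    · exact ⟨fun g => hτ.false g.symm⟩
    · exact absurd rfl hij
  · obtain ⟨r, hr⟩ := Nat.exists_eq_add_of_le' hd
    have e1 : gnum (Nat.card K) (r + 3) = Nat.card K * gnum (Nat.card K) (r + 2) + 1 :=
      gnum_succ' _ _
    have h4 : 4 ≤ gnum (Nat.card K) (r + 2) ∧ 13 ≤ gnum (Nat.card K) (r + 3) := by
      have e2 : gnum (Nat.card K) (r + 2) = Nat.card K * gnum (Nat.card K) (r + 1) + 1 :=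
        gnum_succ' _ _
      have e3 : gnum (Nat.card K) (r + 1) = Nat.card K * gnum (Nat.card K) r + 1 := gnum_succ' _ _
      rcases Nat.lt_or_ge 2 (Nat.card K) with h | h
      · constructor <;> nlinarith
      · have hK : Nat.card K = 2 := le_antisymm h hq
        rw [hK] at e1 e2 e3 ⊢
        have hr1 : r ≠ 0 := fun h => h23 ⟨hK, by omega⟩
        obtain ⟨r', rfl⟩ := Nat.exists_eq_succ_of_ne_zero hr1
        have e4 := gnum_succ' 2 r'
        rw [Nat.succ_eq_add_one] at e1 e2 e3 ⊢
        omega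
    refine hM.exists_pairwise_not_iso hd2 hE ?_ ?_ ?_
    · rw [hr]; exact h4.2
    · rw [hr]; exact h4.1
    · exact two_mul_le_factorial_gnum hq hd h23
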